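/- Conventions. A group is *finitely related* if it has a presentation with an arbitrary set of generators and finitely many relators. A group $\Gamma$ is *PTFA* (poly-(torsion-free-abelian)) if it has a finite series of subgroups from $\{1\}$ to $\Gamma$, each normal in the next, whose successive quotients are torsion-free abelian. For a group homomorphism $\psi:B\to\Gamma$ and a ring $S$ equal to $\mathbb{Q}\Gamma$ or to a skew field containing $\mathbb{Q}\Gamma$, $H_*(B;S)$ denotes group homology with coefficients in $S$, on which $B$ acts by left multiplication through $\psi$; it is a right $S$-module. For $\phi:A\to B$, the group $A$ acts on $S$ through $\psi\circ\phi$. A right module over a ring $R$ is *$R$-torsion* if each of its elements is annihilated by some non-zero element of $R$. **Proposition.** Let $\phi:A\to B$ be a homomorphism of groups, with $A$ finitely generated and $B$ finitely related, such that $\phi_*:H_1(A;\mathbb{Q})\to H_1(B;\mathbb{Q})$ is injective. (1) Let $B_0$ be a normal subgroup of $B$ such that $\Gamma=B/B_0$ is PTFA, and suppose that $H_2(B;\mathbb{Q})$ is spanned by $\phi_*(H_2(A;\mathbb{Q}))$ together with the image of the inclusion-induced map $H_2(B_0;\mathbb{Q})\to H_2(B;\mathbb{Q})$. Then the kernel of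 $\phi_*:H_1(A;\mathbb{Q}\Gamma)\to H_1(B;\mathbb{Q}\Gamma)$ is a $\mathbb{Q}\Gamma$-torsion module. If moreover $H_1(A;\mathbb{Q})\to H_1(B;\mathbb{Q})$ is surjective, then the cokernel of $H_1(A;\mathbb{Q}\Gamma)\to H_1(B;\mathbb{Q}\Gamma)$ is a $\mathbb{Q}\Gamma$-torsion module. (2) Let $\psi:B\to\Gamma$ be a homomorphism (not necessarily surjective) to a PTFA group $\Gamma$, let $B_0=\ker\psi$, and suppose that $H_2(B;\mathbb{Q})$ is spanned by $\phi_*(H_2(A;\mathbb{Q}))$ together with the image of $H_2(B_0;\mathbb{Q})\to H_2(B;\mathbb{Q})$. Then $\mathbb{Q}\Gamma$ has a classical skew field of right fractions $\mathcal{K}\Gamma$, and $\phi_*:H_1(A;\mathcal{K}\Gamma)\to H_1(B;\mathcal{K}\Gamma)$ is injective for any such skew field. If moreover $H_1(A;\mathbb{Q})\to H_1(B;\mathbb{Q})$ is surjective, then $\phi_*:H_1(A;\mathcal{K}\Gamma)\to H_1(B;\mathcal{K}\Gamma)$ is an isomorphism. -/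

import Mathlib

open CategoryTheory

/-- A group is *poly-(torsion-free-abelian)* (PTFA) if it has a finite series of subgroups from
the trivial subgroup to the whole group, each one normal in the next, such that the successive
quotients are torsion-free abelian groups. -/
def IsPTFA (G : Type) [Group G] : Prop :=
  ∃ (n : ℕ) (H : ℕ → Subgroup G), H 0 = ⊥ ∧ H n = ⊤ ∧
    ∀ i < n, H i ≤ H (i + 1) ∧
      ∃ _ : ((H i).subgroupOf (H (i + 1))).Normal,
        (∀ x y : H (i + 1) ⧸ (H i).subgroupOf (H (i + 1)), x * y = y * x) ∧
        IsMulTorsionFree (H (i + 1) ⧸ (H i).subgroupOf (H (i + 1)))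

/-- A group is *finitely related* if it has a presentation with an arbitrary set of generators
and finitely many relators. -/
def IsFinitelyRelated (G : Type) [Group G] : Prop :=
  ∃ (α : Type) (rels : Set (FreeGroup α)), rels.Finite ∧ Nonempty (G ≃* PresentedGroup rels)

/-- A module over a (possibly noncommutative) ring is a torsion module if each of its elements is
annihilated by some non-zero element of the ring. -/
def IsTorsionModule (R M : Type) [Ring R] [AddCommGroup M] [Module R M] : Prop :=
  ∀ m : M, ∃ r : R, r ≠ 0 ∧ r • m = 0

/-- The division ring `K` together with the map `ι : R → K` is a classical skew field of right
fractions of `R`: the map is injective and each element of `K` is of the form `r s⁻¹`. -/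
structure IsRightFractionField {R K : Type} [Ring R] [DivisionRing K] (ι : R →+* K) : Prop where
  injective : Function.Injective ι
  exists_eq : ∀ x : K, ∃ r s : R, s ≠ 0 ∧ x = ι r * (ι s)⁻¹

noncomputable section

/-- The map `Hₙ(A; ℚ) → Hₙ(B; ℚ)` induced by a group homomorphism (trivial coefficients). -/
def rationalHomologyMap {A B : Type} [Group A] [Group B] (φ : A →* B) (n : ℕ) :
    groupHomology (Rep.trivial ℚ A ℚ) n →ₗ[ℚ] groupHomology (Rep.trivial ℚ B ℚ) n :=
  (groupHomology.map (A := Rep.trivial ℚ A ℚ) (B := Rep.trivial ℚ B ℚ) φ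
    (𝟙 (Rep.trivial ℚ A ℚ)) n).hom

section Twisted

variable {G A B K : Type} [Group G] [Group A] [Group B] [Ring K] [Algebra ℚ K]

/-- The coefficient system given by a multiplicative map `ρ : G → K` to a `ℚ`-algebra `K`: the
group `G` acts on `K` by `g • x = ρ g * x`. -/
abbrev coeffRep (ρ : G →* K) : Rep ℚ G :=
  Rep.of (((Algebra.lmul ℚ K : K →ₐ[ℚ] Module.End ℚ K) : K →* Module.End ℚ K).comp ρ :
    Representation ℚ G K)

/-- Right multiplication by an element of `K`, an endomorphism of the coefficient system. -/
def coeffRightMul (ρ : G →* K) (c : K) : coeffRep ρ ⟶ coeffRep ρ :=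
  Rep.ofHom ⟨LinearMap.mulRight ℚ c, fun g => by ext x; simp [mul_assoc]⟩

/-- The homology `Hₙ(G; K)` with coefficients twisted by `ρ : G → K`. -/
def TwistedHomology (ρ : G →* K) (n : ℕ) : Type :=
  groupHomology (coeffRep ρ) n

instance (ρ : G →* K) (n : ℕ) : AddCommGroup (TwistedHomology ρ n) :=
  inferInstanceAs (AddCommGroup (groupHomology (coeffRep ρ) n))

/-- The endomorphism of `Hₙ(G; K)` induced by right multiplication by an element of `K`. -/
def twistedRightMul (ρ : G →* K) (n : ℕ) (c : K) :
    TwistedHomology ρ n →+ TwistedHomology ρ n :=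
  ((groupHomology.map (A := coeffRep ρ) (B := coeffRep ρ) (MonoidHom.id G) (coeffRightMul ρ c) n).hom :
    groupHomology (coeffRep ρ) n →ₗ[ℚ] groupHomology (coeffRep ρ) n).toAddMonoidHom

lemma twistedRightMul_add (ρ : G →* K) (n : ℕ) (c d : K) (x : TwistedHomology ρ n) :
    twistedRightMul ρ n (c + d) x = twistedRightMul ρ n c x + twistedRightMul ρ n d x := by
  have h : groupHomology.chainsMap (A := coeffRep ρ) (B := coeffRep ρ) (MonoidHom.id G) (coeffRightMul ρ (c + d)) =
      groupHomology.chainsMap (A := coeffRep ρ) (B := coeffRep ρ) (MonoidHom.id G) (coeffRightMul ρ c) +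
        groupHomology.chainsMap (A := coeffRep ρ) (B := coeffRep ρ) (MonoidHom.id G) (coeffRightMul ρ d) := by
    refine HomologicalComplex.hom_ext _ _ fun i => ModuleCat.hom_ext ?_
    rw [HomologicalComplex.add_f_apply, ModuleCat.hom_add]
    simp only [groupHomology.chainsMap_id_f_hom_eq_mapRange]
    refine Finsupp.lhom_ext fun g m => ?_
    simp only [LinearMap.add_apply, Finsupp.mapRange.linearMap_apply, Finsupp.mapRange_single]
    rw [← Finsupp.single_add]
    exact congrArg _ (mul_add m c d)
  have h2 : groupHomology.map (A := coeffRep ρ) (B := coeffRep ρ) (MonoidHom.id G) (coeffRightMul ρ (c + d)) n =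
      groupHomology.map (A := coeffRep ρ) (B := coeffRep ρ) (MonoidHom.id G) (coeffRightMul ρ c) n +
        groupHomology.map (A := coeffRep ρ) (B := coeffRep ρ) (MonoidHom.id G) (coeffRightMul ρ d) n := by
    simp only [groupHomology.map, h]
    exact HomologicalComplex.homologyMap_add _ _ _
  exact congrArg (fun f => f.hom x) h2

lemma twistedRightMul_one (ρ : G →* K) (n : ℕ) (x : TwistedHomology ρ n) :
    twistedRightMul ρ n 1 x = x := by
  have h : coeffRightMul ρ (1 : K) = 𝟙 _ := by
    ext y; exact mul_one y
  have h2 : groupHomology.map (A := coeffRep ρ) (B := coeffRep ρ) (MonoidHom.id G) (coeffRightMul ρ (1 : K)) n = 𝟙 _ := by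
    rw [h]; exact groupHomology.map_id n
  exact congrArg (fun f => f.hom x) h2

lemma twistedRightMul_mul (ρ : G →* K) (n : ℕ) (c d : K) (x : TwistedHomology ρ n) :
    twistedRightMul ρ n (c * d) x = twistedRightMul ρ n d (twistedRightMul ρ n c x) := by
  have h : coeffRightMul ρ (c * d) = coeffRightMul ρ c ≫ coeffRightMul ρ d := by
    ext y; exact (mul_assoc y c d).symm
  have h2 : groupHomology.map (A := coeffRep ρ) (B := coeffRep ρ) (MonoidHom.id G) (coeffRightMul ρ (c * d)) n =
      groupHomology.map (A := coeffRep ρ) (B := coeffRep ρ) (MonoidHom.id G) (coeffRightMul ρ c) n ≫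
        groupHomology.map (A := coeffRep ρ) (B := coeffRep ρ) (MonoidHom.id G) (coeffRightMul ρ d) n := by
    rw [h]; exact groupHomology.map_id_comp _ _ n
  exact congrArg (fun f => f.hom x) h2

/-- `Hₙ(G; K)` is a right `K`-module: `K` acts through right multiplication on coefficients. -/
instance (ρ : G →* K) (n : ℕ) : Module Kᵐᵒᵖ (TwistedHomology ρ n) where
  smul c x := twistedRightMul ρ n c.unop x
  one_smul x := twistedRightMul_one ρ n x
  mul_smul c d x := twistedRightMul_mul ρ n d.unop c.unop x
  smul_zero c := map_zero (twistedRightMul ρ n c.unop)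
  smul_add c := map_add (twistedRightMul ρ n c.unop)
  add_smul c d x := twistedRightMul_add ρ n c.unop d.unop x
  zero_smul x := by
    have h := twistedRightMul_add ρ n 0 0 x
    rw [add_zero] at h
    exact left_eq_add.1 h

/-- The `K`-linear map `Hₙ(A; K) → Hₙ(B; K)` induced by `φ : A → B`, where the coefficient system
of `A` is the restriction along `φ` of that of `B`. -/
def TwistedHomology.map (φ : A →* B) (ρ : B →* K) (n : ℕ) :
    TwistedHomology (ρ.comp φ) n →ₗ[Kᵐᵒᵖ] TwistedHomology ρ n where
  toFun x := (groupHomology.map (A := coeffRep (ρ.comp φ)) (B := coeffRep ρ) φ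
    (𝟙 (coeffRep (ρ.comp φ))) n).hom x
  map_add' x y := map_add (groupHomology.map (A := coeffRep (ρ.comp φ)) (B := coeffRep ρ) φ
    (𝟙 (coeffRep (ρ.comp φ))) n).hom x y
  map_smul' c x := by
    have h : groupHomology.map (MonoidHom.id A) (coeffRightMul (ρ.comp φ) c.unop) n ≫
          groupHomology.map (A := coeffRep (ρ.comp φ)) (B := coeffRep ρ) φ
            (𝟙 (coeffRep (ρ.comp φ))) n =
        groupHomology.map (A := coeffRep (ρ.comp φ)) (B := coeffRep ρ) φ
            (𝟙 (coeffRep (ρ.comp φ))) n ≫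
          groupHomology.map (MonoidHom.id B) (coeffRightMul ρ c.unop) n := by
      refine (groupHomology.map_comp (A := coeffRep (ρ.comp φ)) (B := coeffRep (ρ.comp φ))
        (C := coeffRep ρ) (MonoidHom.id A) φ (coeffRightMul (ρ.comp φ) c.unop)
        (𝟙 (coeffRep (ρ.comp φ))) n).symm.trans ?_
      refine Eq.trans ?_ (groupHomology.map_comp (A := coeffRep (ρ.comp φ)) (B := coeffRep ρ)
        (C := coeffRep ρ) φ (MonoidHom.id B) (𝟙 (coeffRep (ρ.comp φ)))
        (coeffRightMul ρ c.unop) n)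
      rfl
    exact congrArg (fun f => f.hom x) h

end Twisted

end

/-!
Let `R = ℚ[Γ]` with augmentation `ε : R → ℚ`, and let `K` be a skew field of right fractions of `R`.
The argument compares ranks over `ℚ` and over `K`.

For a PTFA group `Γ`, Strebel's theorem (`IsPTFA.strebelCondition`) says that a homomorphism of free
`R`-modules that becomes injective under `ε` is injective. It follows by induction along the series:
for a torsion-free abelian group one uses determinants over a commutative domain, and the property
passes to extensions. Consequently vectors over `R` whose augmentations are linearly independent
over `ℚ` are linearly independent over `K` (`IsPTFA.independenceCondition`), so that the rank of a
matrix over `R` can only go up from `ℚ` to `K`.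

The skew field exists because `R` is an Ore domain. It has no zero divisors since `Γ` has unique
products (`IsPTFA.uniqueProds`), and it satisfies the Ore condition because a homomorphism
`R ^ m → R ^ n` with `n < m` is not injective (`IsPTFA.homRankCondition`). That property passes to
extensions with abelian quotient by counting cosets in a Følner set.

Now let `π : F → B` be a free presentation with finitely many relators `r j`, and let `w i` in `F`
be lifts of the images of finitely many generators `a i` of `A`. Every 1-chain of `A` is homologous
to a combination of the `[a i]`, and a 1-chain of `F` that bounds in `B` is, up to boundaries of
`F`, a combination of the `[r j]`. The boundaries of `F` are the kernel of the Fox derivatives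
(`foxChain_eq_zero_iff`). Hence the kernel and the cokernel of `H₁(A) → H₁(B)`, with any
coefficients, are controlled by one linear system `J` with finitely many unknowns: the Fox
derivatives of the words `w i` and `r j`.

For injectivity, a rational solution of `J` is a combination of the `[w i]` and `[r j]` that bounds
in `F`. Its part in `A` bounds because `H₁(A; ℚ) → H₁(B; ℚ)` is injective, and the two bounding
2-chains differ in `B` by a rational 2-cycle. The hypothesis on `H₂(B; ℚ)` writes this cycle as one
from `A` plus one from `B₀` plus a boundary. Cycles of `B₀` stay cycles over `R`, as `B₀` acts
trivially, and so all these chains can be lifted to `R`, with an error in the augmentation ideal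
that is absorbed by correcting the coefficients of the `[a i]` and `[r j]` within that ideal
(`exists_lift_of_mem_range_barD₂`). Thus each rational solution is the augmentation of a solution
over `R` that bounds in `A`. By the rank inequality these lifts span all solutions over `K`
(`IndependenceCondition.mem_span_of_rightComb_eq_zero`), so every solution over `K` bounds in `A`.

For surjectivity, if `H₁(A; ℚ) → H₁(B; ℚ)` is onto then `J` is solvable for every right-hand side
over `ℚ`, hence over `K` (`IndependenceCondition.rightComb_surjective`). The statements on torsion
follow from those over `K` by clearing denominators.
-/

/-! ### PTFA groups and unique products -/

section PTFAGroups

/-- Induction principle for PTFA groups: it suffices that a property holds for trivial groups and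
passes to extensions of a torsion-free abelian group. -/
theorem IsPTFA.induction {P : ∀ (G : Type) [Group G], Prop}
    (trivial : ∀ (G : Type) [Group G] [Subsingleton G], P G)
    (extension : ∀ (N G Q : Type) [Group N] [Group G] [CommGroup Q] [IsMulTorsionFree Q]
      (_ : GroupExtension N G Q), P N → P G)
    {G : Type} [Group G] (hG : IsPTFA G) : P G := by
  obtain ⟨n, H, h0, hn, h⟩ := hG
  have key : ∀ k ≤ n, P (H k) := by
    intro k
    induction k with
    | zero =>
      intro _
      have : Subsingleton (H 0) := by rw [h0]; infer_instance
      exact trivial _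
    | succ k ih =>
      intro hk
      obtain ⟨hle, hnorm, hcomm, htf⟩ := h k hk
      let _ : CommGroup (H (k + 1) ⧸ (H k).subgroupOf (H (k + 1))) :=
        { (inferInstance : Group (H (k + 1) ⧸ (H k).subgroupOf (H (k + 1)))) with
          mul_comm := hcomm }
      refine extension (H k) (H (k + 1)) (H (k + 1) ⧸ (H k).subgroupOf (H (k + 1)))
        { inl := Subgroup.inclusion hle
          rightHom := QuotientGroup.mk' _
          inl_injective := Subgroup.inclusion_injective hle
          range_inl_eq_ker_rightHom := ?_
          rightHom_surjective := QuotientGroup.mk'_surjective _ } (ih (by omega))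
      rw [Subgroup.inclusion_range]
      exact (QuotientGroup.ker_mk' _).symm
  have := key n le_rfl
  refine extension (H n) G PUnit
    { inl := (H n).subtype
      rightHom := 1
      inl_injective := Subgroup.subtype_injective _
      range_inl_eq_ker_rightHom := ?_
      rightHom_surjective := fun x => ⟨1, rfl⟩ } this
  rw [hn]; ext; simp

/-- A product of cosets that is unique in `Q` is chosen first; translating its two factors back into
`N` reduces uniqueness to `N`. -/
theorem UniqueProds.of_extension {N G Q : Type*} [Group N] [Group G] [Group Q] [UniqueProds N]
    [UniqueProds Q] (S : GroupExtension N G Q) : UniqueProds G where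
  uniqueMul_of_nonempty {A B} hA hB := by
    classical
    obtain ⟨_, ha, _, hb, hu⟩ :=
      UniqueProds.uniqueMul_of_nonempty (hA.image S.rightHom) (hB.image S.rightHom)
    obtain ⟨a₀, ha₀, rfl⟩ := Finset.mem_image.1 ha
    obtain ⟨b₀, hb₀, rfl⟩ := Finset.mem_image.1 hb
    have inj₁ : Function.Injective fun n => a₀ * S.inl n :=
      fun x y h => S.inl_injective (mul_left_cancel h)
    have inj₂ : Function.Injective fun n => S.inl n * b₀ :=
      fun x y h => S.inl_injective (mul_right_cancel h)
    have lift : ∀ g : G, S.rightHom g = 1 → ∃ n, S.inl n = g := fun g hg =>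
      MonoidHom.mem_range.1 (S.range_inl_eq_ker_rightHom ▸ (MonoidHom.mem_ker.2 hg))
    obtain ⟨n, hn, m, hm, hnm⟩ := UniqueProds.uniqueMul_of_nonempty
      (A := A.preimage _ inj₁.injOn) (B := B.preimage _ inj₂.injOn)
      ⟨1, by simpa using ha₀⟩ ⟨1, by simpa using hb₀⟩
    refine ⟨_, Finset.mem_preimage.1 hn, _, Finset.mem_preimage.1 hm, fun a b ha hb hab => ?_⟩
    obtain ⟨h₁, h₂⟩ := hu (Finset.mem_image_of_mem S.rightHom ha)
      (Finset.mem_image_of_mem S.rightHom hb)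
      (by rw [← map_mul, hab]; simp)
    obtain ⟨n', hn'⟩ := lift (a₀⁻¹ * a) (by simp [h₁])
    obtain ⟨m', hm'⟩ := lift (b * b₀⁻¹) (by simp [h₂])
    have ea : a = a₀ * S.inl n' := by rw [hn']; group
    have eb : b = S.inl m' * b₀ := by rw [hm']; group
    subst ea eb
    obtain ⟨rfl, rfl⟩ := hnm (a := n') (b := m') (by simpa using ha) (by simpa using hb)
      (S.inl_injective (by
        simp only [mul_assoc, mul_right_inj] at hab
        simpa only [← mul_assoc, mul_left_inj, map_mul] using hab))
    exact ⟨rfl, rfl⟩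

/-- Uniqueness of products only involves the subgroup generated by the two finite sets, and a
finitely generated torsion-free abelian group is known to have unique products. -/
theorem UniqueProds.of_isMulTorsionFree (G : Type*) [CommGroup G] [IsMulTorsionFree G] :
    UniqueProds G where
  uniqueMul_of_nonempty {A B} hA hB := by
    classical
    let H := Subgroup.closure ((A ∪ B : Finset G) : Set G)
    have hAH : ∀ a ∈ A, a ∈ H := fun a ha => Subgroup.subset_closure (by simp [ha])
    have hBH : ∀ a ∈ B, a ∈ H := fun a ha => Subgroup.subset_closure (by simp [ha])
    have : Group.FG H := Group.closure_finset_fg _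
    have : Monoid.FG H := Group.fg_iff_monoid_fg.1 this
    have : IsMulTorsionFree H := Subgroup.subtype_injective H |>.isMulTorsionFree H.subtype
    obtain ⟨⟨a, _⟩, ha, ⟨b, _⟩, hb, hab⟩ := UniqueProds.uniqueMul_of_nonempty
      (A := A.subtype (· ∈ H)) (B := B.subtype (· ∈ H))
      (by obtain ⟨a, ha⟩ := hA; exact ⟨⟨a, hAH a ha⟩, by simpa using ha⟩)
      (by obtain ⟨a, ha⟩ := hB; exact ⟨⟨a, hBH a ha⟩, by simpa using ha⟩)
    refine ⟨a, by simpa using ha, b, by simpa using hb, fun x y hx hy hxy => ?_⟩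
    have := hab (a := ⟨x, hAH x hx⟩) (b := ⟨y, hBH y hy⟩) (by simpa using hx) (by simpa using hy)
      (Subtype.ext hxy)
    simpa using this

theorem IsPTFA.uniqueProds {G : Type} [Group G] (hG : IsPTFA G) : UniqueProds G := by
  refine hG.induction (P := fun G _ => UniqueProds G) (fun G _ _ => ⟨fun {A B} hA hB => ?_⟩)
    fun N G Q _ _ _ _ S hN => ?_
  · obtain ⟨a, ha⟩ := hA
    obtain ⟨b, hb⟩ := hB
    exact ⟨a, ha, b, hb, UniqueMul.of_subsingleton⟩
  · have := UniqueProds.of_isMulTorsionFree Q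
    exact .of_extension S

end PTFAGroups

/-! ### Homomorphisms of free modules over group rings and extensions -/

section Equivariant

variable {G V W : Type*} [AddCommGroup V] [Module ℚ V] [AddCommGroup W] [Module ℚ W]

/-- The sum of all coefficients. It is the projection of the free right `ℚ[G]`-module
`V ⊗ ℚ[G]`, modelled as `G →₀ V`, onto its coinvariants `V`. -/
noncomputable def coeffSum (G V : Type*) [AddCommGroup V] [Module ℚ V] : (G →₀ V) →ₗ[ℚ] V :=
  Finsupp.lsum ℚ fun _ => LinearMap.id

@[simp] lemma coeffSum_single (g : G) (v : V) : coeffSum G V (.single g v) = v := by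
  simp [coeffSum]

lemma coeffSum_mapDomain {H : Type*} (p : G → H) (x : G →₀ V) :
    coeffSum H V (x.mapDomain p) = coeffSum G V x := by
  induction x using Finsupp.induction_linear with
  | zero => simp
  | add x y hx hy => simp [Finsupp.mapDomain_add, hx, hy]
  | single g v => rw [Finsupp.mapDomain_single, coeffSum_single, coeffSum_single]

variable [Group G]

/-- The property of a `ℚ`-linear map between the free modules `G →₀ V` and `G →₀ W` of commuting
with right translation by `G`, that is, of being a homomorphism of right `ℚ[G]`-modules. -/
def RightEquivariant (f : (G →₀ V) →ₗ[ℚ] (G →₀ W)) : Prop :=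
  ∀ (g : G) (x : G →₀ V), f (x.mapDomain (· * g)) = (f x).mapDomain (· * g)

lemma RightEquivariant.apply_single {f : (G →₀ V) →ₗ[ℚ] (G →₀ W)} (hf : RightEquivariant f)
    (g : G) (v : V) : f (.single g v) = (f (.single 1 v)).mapDomain (· * g) := by
  rw [← hf, Finsupp.mapDomain_single, one_mul]

lemma rightEquivariant_iff_single {f : (G →₀ V) →ₗ[ℚ] (G →₀ W)} :
    RightEquivariant f ↔ ∀ (g h : G) (v : V),
      f (.single (h * g) v) = (f (.single h v)).mapDomain (· * g) := by
  refine ⟨fun hf g h v => by rw [← hf, Finsupp.mapDomain_single], fun hf g x => ?_⟩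
  induction x using Finsupp.induction_linear with
  | zero => simp
  | add x y hx hy => simp [Finsupp.mapDomain_add, hx, hy]
  | single h v => rw [Finsupp.mapDomain_single, hf]

end Equivariant

/-- Strebel's condition on a group `G`: a homomorphism of free `ℚ[G]`-modules (of any rank) that
becomes injective after tensoring with the trivial module `ℚ` is injective. -/
def StrebelCondition (G : Type) [Group G] : Prop :=
  ∀ (V W : Type) [AddCommGroup V] [Module ℚ V] [AddCommGroup W] [Module ℚ W]
    (f : (G →₀ V) →ₗ[ℚ] (G →₀ W)), RightEquivariant f →
    Function.Injective (fun v => coeffSum G W (f (.single 1 v))) → Function.Injective f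

/-- The rank condition on a group `G`: a homomorphism of free `ℚ[G]`-modules from a larger to a
smaller finite rank has a kernel. -/
def HomRankCondition (G : Type) [Group G] : Prop :=
  ∀ (V W : Type) [AddCommGroup V] [Module ℚ V] [AddCommGroup W] [Module ℚ W]
    [FiniteDimensional ℚ V] [FiniteDimensional ℚ W]
    (f : (G →₀ V) →ₗ[ℚ] (G →₀ W)), RightEquivariant f →
    Module.finrank ℚ W < Module.finrank ℚ V → ¬ Function.Injective f

section Extension

variable {N G Q : Type} [Group N] [Group G] [Group Q] (S : GroupExtension N G Q)

/-- An extension `G` of `Q` by `N` is, as a right `N`-set, the product `N × Q`; the choice of a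
set-theoretic section of `G → Q` is involved. -/
noncomputable def extensionEquiv : N × Q ≃ G :=
  Equiv.ofBijective (fun x => Function.surjInv S.rightHom_surjective x.2 * S.inl x.1) <| by
    refine ⟨fun ⟨n, q⟩ ⟨n', q'⟩ h => ?_, fun g => ?_⟩
    · have hq : q = q' := by
        simpa [Function.surjInv_eq S.rightHom_surjective] using congrArg S.rightHom h
      subst hq
      have := S.inl_injective (mul_left_cancel h)
      simpa using this
    · obtain ⟨n, hn⟩ : (Function.surjInv S.rightHom_surjective (S.rightHom g))⁻¹ * g ∈
          S.inl.range := by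
        rw [S.range_inl_eq_ker_rightHom, MonoidHom.mem_ker, map_mul, map_inv,
          Function.surjInv_eq S.rightHom_surjective, inv_mul_cancel]
      exact ⟨(n, S.rightHom g), by simp [hn]⟩

@[simp] lemma extensionEquiv_apply (n : N) (q : Q) :
    extensionEquiv S (n, q) = Function.surjInv S.rightHom_surjective q * S.inl n := rfl

/-- For an extension `G` of `Q` by `N`, the free `ℚ[G]`-module on `V` is the free `ℚ[N]`-module
on `Q →₀ V`. -/
noncomputable def extensionLEquiv (V : Type) [AddCommGroup V] [Module ℚ V] :
    (N →₀ Q →₀ V) ≃ₗ[ℚ] (G →₀ V) :=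
  (Finsupp.curryLinearEquiv ℚ).symm ≪≫ₗ Finsupp.domLCongr (extensionEquiv S)

variable {V W : Type} [AddCommGroup V] [Module ℚ V] [AddCommGroup W] [Module ℚ W]

@[simp] lemma extensionLEquiv_single (n : N) (q : Q) (v : V) :
    extensionLEquiv S V (.single n (.single q v)) =
      .single (Function.surjInv S.rightHom_surjective q * S.inl n) v := by
  simp [extensionLEquiv]

lemma extensionLEquiv_mapDomain (n : N) (x : N →₀ Q →₀ V) :
    extensionLEquiv S V (x.mapDomain (· * n)) =
      (extensionLEquiv S V x).mapDomain (· * S.inl n) := by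
  induction x using Finsupp.induction_linear with
  | zero => simp
  | add x y hx hy => simp [Finsupp.mapDomain_add, hx, hy]
  | single m u =>
    induction u using Finsupp.induction_linear with
    | zero => simp
    | add x y hx hy => simp only [Finsupp.single_add, Finsupp.mapDomain_add, hx, hy, map_add]
    | single q v => simp [mul_assoc]

lemma coeffSum_eq_mapDomain_extensionLEquiv (x : N →₀ Q →₀ V) :
    coeffSum N _ x = (extensionLEquiv S V x).mapDomain S.rightHom := by
  induction x using Finsupp.induction_linear with
  | zero => simp
  | add x y hx hy => simp [Finsupp.mapDomain_add, hx, hy]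
  | single m u =>
    induction u using Finsupp.induction_linear with
    | zero => simp
    | add x y hx hy => simp only [Finsupp.single_add, Finsupp.mapDomain_add, hx, hy, map_add]
    | single q v => simp [Function.surjInv_eq S.rightHom_surjective]

/-- A homomorphism of free `ℚ[G]`-modules as a homomorphism of free `ℚ[N]`-modules. -/
noncomputable def restrictExtension (f : (G →₀ V) →ₗ[ℚ] (G →₀ W)) :
    (N →₀ Q →₀ V) →ₗ[ℚ] (N →₀ Q →₀ W) :=
  (extensionLEquiv S W).symm.toLinearMap ∘ₗ f ∘ₗ
    (extensionLEquiv S V).toLinearMap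

lemma extensionLEquiv_restrictExtension (f : (G →₀ V) →ₗ[ℚ] (G →₀ W)) (x : N →₀ Q →₀ V) :
    extensionLEquiv S W (restrictExtension S f x) =
      f (extensionLEquiv S V x) := by
  simp [restrictExtension]

lemma RightEquivariant.restrictExtension {f : (G →₀ V) →ₗ[ℚ] (G →₀ W)}
    (hf : RightEquivariant f) : RightEquivariant (restrictExtension S f) := by
  intro n x
  apply (extensionLEquiv S W).injective
  rw [extensionLEquiv_mapDomain, extensionLEquiv_restrictExtension,
    extensionLEquiv_restrictExtension, extensionLEquiv_mapDomain, hf]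

/-- Dividing out `N` turns a homomorphism of free `ℚ[G]`-modules into one of free `ℚ[Q]`-modules,
which is injective by the condition on `Q`. As a homomorphism of free `ℚ[N]`-modules the original
map then satisfies the hypothesis of the condition on `N`. -/
theorem StrebelCondition.of_extension (S : GroupExtension N G Q) (hN : StrebelCondition N)
    (hQ : StrebelCondition Q) : StrebelCondition G := by
  intro V W _ _ _ _ f hf hinj
  -- `g` is the homomorphism of free `ℚ[Q]`-modules obtained by dividing out the action of `N`
  let g : (Q →₀ V) →ₗ[ℚ] (Q →₀ W) := Finsupp.lsum ℚ fun q =>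
    Finsupp.lmapDomain W ℚ S.rightHom ∘ₗ f ∘ₗ
      Finsupp.lsingle (Function.surjInv S.rightHom_surjective q)
  have hg : ∀ x, g (x.mapDomain S.rightHom) = (f x).mapDomain S.rightHom := by
    intro x
    induction x using Finsupp.induction_linear with
    | zero => simp
    | add x y hx hy => simp [Finsupp.mapDomain_add, hx, hy]
    | single h v =>
      obtain ⟨⟨n, q⟩, rfl⟩ := (extensionEquiv S).surjective h
      have hq : S.rightHom (extensionEquiv S (n, q)) = q := by
        simp [Function.surjInv_eq S.rightHom_surjective]
      have : Finsupp.single (extensionEquiv S (n, q)) v =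
          (Finsupp.single (Function.surjInv S.rightHom_surjective q) v).mapDomain
            (· * S.inl n) := by
        simp
      rw [Finsupp.mapDomain_single, hq, this, hf, ← Finsupp.mapDomain_comp]
      have : S.rightHom ∘ (· * S.inl n) = S.rightHom := by ext; simp
      rw [this]
      simp [g]
  have hg_equiv : RightEquivariant g := by
    intro q x
    obtain ⟨x, rfl⟩ := Finsupp.mapDomain_surjective S.rightHom_surjective x
    obtain ⟨h, rfl⟩ := S.rightHom_surjective q
    have : (· * S.rightHom h) ∘ S.rightHom = S.rightHom ∘ (· * h) := by ext; simp
    rw [← Finsupp.mapDomain_comp, this, Finsupp.mapDomain_comp, hg, hg, hf,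
      ← Finsupp.mapDomain_comp, ← Finsupp.mapDomain_comp, this]
  have hg_inj : Function.Injective g := by
    refine hQ V W g hg_equiv ?_
    convert hinj using 2 with v
    have := hg (.single 1 v)
    rw [Finsupp.mapDomain_single, map_one] at this
    rw [this, coeffSum_mapDomain]
  have := hN _ _ _ (hf.restrictExtension S) <| by
    convert hg_inj using 2 with u
    rw [coeffSum_eq_mapDomain_extensionLEquiv S, extensionLEquiv_restrictExtension,
      ← hg, ← coeffSum_eq_mapDomain_extensionLEquiv, coeffSum_single]
  intro x y hxy
  obtain ⟨x, rfl⟩ := (extensionLEquiv S V).surjective x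
  obtain ⟨y, rfl⟩ := (extensionLEquiv S V).surjective y
  rw [← extensionLEquiv_restrictExtension, ← extensionLEquiv_restrictExtension] at hxy
  rw [this ((extensionLEquiv S W).injective hxy)]

end Extension

/-! ### Følner sets, ranks and Strebel's theorem -/

section Folner

open Finset Pointwise

/-- In a commutative group the powers of a finite set grow polynomially. -/
theorem Finset.card_pow_le_of_commGroup {Q : Type*} [CommGroup Q] [DecidableEq Q] (s : Finset Q)
    (k : ℕ) : #(s ^ k) ≤ (k + 1) ^ #s := by
  have hsub : s ^ k ⊆ (Fintype.piFinset fun _ : s => range (k + 1)).image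
      fun e => ∏ a : s, (a : Q) ^ e a := by
    induction k with
    | zero =>
      intro x hx
      rw [pow_zero, mem_one] at hx
      exact mem_image.2 ⟨fun _ => 0, by simp, by simp [hx]⟩
    | succ k ih =>
      intro x hx
      rw [pow_succ] at hx
      obtain ⟨y, hy, a, ha, rfl⟩ := mem_mul.1 hx
      obtain ⟨e, he, rfl⟩ := mem_image.1 (ih hy)
      refine mem_image.2 ⟨e + Pi.single ⟨a, ha⟩ 1, ?_, ?_⟩
      · simp only [Fintype.mem_piFinset, mem_range, Pi.add_apply] at he ⊢
        intro b
        have := he b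
        by_cases hb : b = ⟨a, ha⟩
        · subst hb; simp; omega
        · simp [hb]; omega
      · simp only [Pi.add_apply, pow_add, prod_mul_distrib]
        congr 1
        rw [Fintype.prod_eq_single (⟨a, ha⟩ : s)]
        · simp
        · intro b hb; simp [hb]
  refine (card_le_card hsub).trans (card_image_le.trans ?_)
  simp

/-- A Følner-type property of commutative groups: a finite set has arbitrarily small relative
growth under multiplication by a given finite set. -/
theorem exists_card_mul_lt_of_commGroup {Q : Type*} [CommGroup Q] [DecidableEq Q] (s : Finset Q)
    {a b : ℕ} (hab : a < b) : ∃ F : Finset Q, F.Nonempty ∧ a * #(s * F) < b * #F := by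
  rcases s.eq_empty_or_nonempty with rfl | hs
  · exact ⟨1, one_nonempty, by simp; omega⟩
  rcases a.eq_zero_or_pos with rfl | ha
  · exact ⟨1, one_nonempty, by simp; omega⟩
  by_contra! H
  have hk : ∀ k, b ^ k ≤ a ^ k * #(s ^ k) := by
    intro k
    induction k with
    | zero => simp
    | succ k ih =>
      calc b ^ (k + 1) ≤ a ^ k * (b * #(s ^ k)) := by
            rw [pow_succ]; calc _ ≤ _ := Nat.mul_le_mul_right b ih
                             _ = _ := by ring
        _ ≤ a ^ k * (a * #(s * s ^ k)) := Nat.mul_le_mul_left _ (H _ hs.pow)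
        _ = a ^ (k + 1) * #(s ^ (k + 1)) := by rw [pow_succ' s]; ring
  have ha' : (0 : ℝ) < a := by exact_mod_cast ha
  have hr : 1 < (b / a : ℝ) := by rw [one_lt_div ha']; exact_mod_cast hab
  have hbound : ∀ k : ℕ, (b / a : ℝ) ^ k ≤ ((k + 1 : ℕ) : ℝ) ^ #s := by
    intro k
    rw [div_pow, div_le_iff₀ (by positivity)]
    calc (b : ℝ) ^ k ≤ a ^ k * #(s ^ k) := by exact_mod_cast hk k
      _ ≤ a ^ k * ((k + 1 : ℕ) : ℝ) ^ #s := by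
        gcongr; exact_mod_cast s.card_pow_le_of_commGroup k
      _ = _ := mul_comm _ _
  have hlim := (tendsto_pow_const_div_const_pow_of_one_lt #s hr).comp
    (Filter.tendsto_add_atTop_nat 1)
  obtain ⟨k, hk⟩ :=
    (hlim.eventually (gt_mem_nhds (show (0 : ℝ) < (b / a : ℝ)⁻¹ by positivity))).exists
  have hpos : 0 < (b / a : ℝ) := by positivity
  rw [Function.comp_apply, div_lt_iff₀ (pow_pos hpos _), pow_succ' (b / a : ℝ), ← mul_assoc,
    inv_mul_cancel₀ hpos.ne', one_mul] at hk
  exact absurd (hbound k) (not_le.2 hk)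

end Folner

section RankExtension

open Finset Pointwise

variable {N G Q : Type} [Group N] [Group G]

lemma extensionLEquiv_apply [Group Q] (S : GroupExtension N G Q) {W : Type} [AddCommGroup W]
    [Module ℚ W] (z : N →₀ Q →₀ W) (n : N) (q : Q) :
    extensionLEquiv S W z (Function.surjInv S.rightHom_surjective q * S.inl n) = z n q := by
  rw [← extensionEquiv_apply]
  simp only [extensionLEquiv, LinearEquiv.trans_apply, Finsupp.domLCongr_apply,
    Finsupp.domCongr_apply, Finsupp.equivMapDomain_apply, Equiv.symm_apply_apply]
  rfl

/-- Let `f` be injective of rank `m → n` with `n < m`. Over the cosets of `N` in a finite set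
`F ⊆ Q` it restricts to a map of free `ℚ[N]`-modules of ranks `m * #F → n * #(s * F)`, for a finite
set `s` depending on `f`. For a Følner set `F` the rank still drops, against the condition
on `N`. -/
theorem HomRankCondition.of_extension [CommGroup Q] (S : GroupExtension N G Q)
    (hN : HomRankCondition N) : HomRankCondition G := by
  classical
  intro V W _ _ _ _ _ _ f hf hlt hinj
  -- a finite set containing the supports of all `f (single 1 v)`
  obtain ⟨s, hs⟩ : ∃ s : Finset G, ∀ v, (f (.single 1 v)).support ⊆ s := by
    let b := Module.finBasis ℚ V
    refine ⟨univ.biUnion fun i => (f (.single 1 (b i))).support, fun v => ?_⟩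
    have : f (.single 1 v) = ∑ i, b.repr v i • f (.single 1 (b i)) := by
      conv_lhs => rw [← b.sum_repr v]
      have := map_sum (f ∘ₗ Finsupp.lsingle 1) (fun i => b.repr v i • b i) univ
      simpa only [LinearMap.comp_apply, Finsupp.lsingle_apply, map_smul] using this
    rw [this]
    exact Finsupp.support_finsetSum.trans
      (biUnion_mono fun i _ => Finsupp.support_smul)
  obtain ⟨F, hF, hcard⟩ := exists_card_mul_lt_of_commGroup (s.image S.rightHom) hlt
  set E := s.image S.rightHom * F with hE
  let j : (F →₀ V) →ₗ[ℚ] (Q →₀ V) := Finsupp.lmapDomain V ℚ Subtype.val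
  let r : (Q →₀ W) →ₗ[ℚ] (E →₀ W) := Finsupp.lsubtypeDomain (E : Set Q)
  have hj : Function.Injective j := Finsupp.mapDomain_injective Subtype.val_injective
  let f' := restrictExtension S f
  have hf' : Function.Injective f' := by
    simpa [f', restrictExtension] using hinj
  -- over the cosets in `F`, the map `f'` only meets the cosets in `E`
  have hsupp : ∀ (x : N →₀ F →₀ V) (n : N), ∀ q ∉ E,
      f' (Finsupp.mapRange.linearMap j x) n q = 0 := by
    intro x n q hq
    induction x using Finsupp.induction_linear with
    | zero => simp
    | add x y hx hy => rw [map_add, map_add, Finsupp.add_apply, Finsupp.add_apply, hx, hy, add_zero]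
    | single m u =>
      induction u using Finsupp.induction_linear with
      | zero => simp
      | add x y hx hy =>
        rw [Finsupp.single_add, map_add, map_add, Finsupp.add_apply, Finsupp.add_apply, hx, hy,
          add_zero]
      | single t v =>
        rw [← extensionLEquiv_apply S, extensionLEquiv_restrictExtension]
        simp only [Finsupp.mapRange.linearMap_apply, Finsupp.mapRange_single, j,
          Finsupp.lmapDomain_apply, Finsupp.mapDomain_single, extensionLEquiv_single]
        rw [hf.apply_single]
        by_contra hne
        have := Finsupp.mapDomain_support (Finsupp.mem_support_iff.2 hne)
        obtain ⟨g, hg, hgq⟩ := mem_image.1 this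
        apply hq
        have := congrArg S.rightHom hgq
        simp only [map_mul, GroupExtension.rightHom_inl, mul_one,
          Function.surjInv_eq S.rightHom_surjective] at this
        exact mem_mul.2 ⟨_, mem_image_of_mem _ (hs v hg), _, t.2, this⟩
  refine hN (F →₀ V) (E →₀ W)
    (Finsupp.mapRange.linearMap r ∘ₗ f' ∘ₗ Finsupp.mapRange.linearMap j) ?_ ?_ ?_
  · rw [rightEquivariant_iff_single]
    intro g h v
    simp only [LinearMap.comp_apply, Finsupp.mapRange.linearMap_apply, Finsupp.mapRange_single]
    rw [rightEquivariant_iff_single.1 (hf.restrictExtension S), Finsupp.mapDomain_mapRange]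
    exact fun _ _ => map_add _ _ _
  · simpa [Module.finrank_finsupp, mul_comm] using hcard
  · rw [← LinearMap.ker_eq_bot, LinearMap.ker_eq_bot']
    intro x hx
    have h0 : f' (Finsupp.mapRange.linearMap j x) = 0 := by
      ext n q
      by_cases hq : q ∈ E
      · have := DFunLike.congr_fun (DFunLike.congr_fun hx n) (⟨q, hq⟩ : E)
        exact this
      · exact hsupp x n q hq
    rw [← map_zero f'] at h0
    have h1 := hf' h0
    rw [← map_zero (Finsupp.mapRange.linearMap j)] at h1
    exact Finsupp.mapRange_injective j (map_zero j) hj h1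

theorem HomRankCondition.of_subsingleton (G : Type) [Group G] [Subsingleton G] :
    HomRankCondition G := by
  intro V W _ _ _ _ _ _ f _ hlt hinj
  let e := Finsupp.uniqueLinearEquiv ℚ V (1 : G)
  let e' := Finsupp.uniqueLinearEquiv ℚ W (1 : G)
  have := LinearMap.finrank_le_finrank_of_injective (f := e'.toLinearMap ∘ₗ f ∘ₗ e.symm.toLinearMap)
    (by simpa using hinj)
  omega

theorem IsPTFA.homRankCondition {G : Type} [Group G] (hG : IsPTFA G) : HomRankCondition G :=
  hG.induction (P := fun G _ => HomRankCondition G) (fun G _ _ => .of_subsingleton G)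
    fun _ _ _ _ _ _ _ S hN => .of_extension S hN

end RankExtension

section Strebel

/-- The augmentation `ℚ[G] → ℚ`. -/
noncomputable def augmentation (G : Type*) [Group G] : MonoidAlgebra ℚ G →ₐ[ℚ] ℚ :=
  MonoidAlgebra.lift ℚ ℚ G 1

@[simp] lemma augmentation_single {G : Type*} [Group G] (g : G) (q : ℚ) :
    augmentation G (.single g q) = q := by
  simp [augmentation]

theorem StrebelCondition.of_subsingleton (G : Type) [Group G] [Subsingleton G] :
    StrebelCondition G := by
  intro V W _ _ _ _ f _ hinj x y hxy
  have hx : ∀ x : G →₀ V, x = .single 1 (x 1) := fun x => by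
    ext g; rw [Subsingleton.elim g 1, Finsupp.single_eq_same]
  have := @hinj (x 1) (y 1) (by simp only; rw [← hx x, ← hx y, hxy])
  rw [hx x, hx y, this]

/-- For a torsion-free abelian group `G` the group ring is a commutative domain, and a square matrix
over it whose augmentation is the identity has non-zero determinant. -/
theorem StrebelCondition.of_isMulTorsionFree (G : Type) [CommGroup G] [IsMulTorsionFree G] :
    StrebelCondition G := by
  classical
  have := UniqueProds.of_isMulTorsionFree G
  intro V W _ _ _ _ f hf hinj
  rw [← LinearMap.ker_eq_bot, LinearMap.ker_eq_bot']
  intro x hx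
  -- restrict to a finite-dimensional `V₀`, and split the augmented map on `V₀`
  let V₀ : Submodule ℚ V := Submodule.span ℚ (x.support.image x)
  have : FiniteDimensional ℚ V₀ := FiniteDimensional.span_finset ℚ _
  let fbar : V₀ →ₗ[ℚ] W := coeffSum G W ∘ₗ f ∘ₗ Finsupp.lsingle 1 ∘ₗ V₀.subtype
  obtain ⟨r, hr⟩ := fbar.exists_leftInverse_of_injective
    (LinearMap.ker_eq_bot.2 fun a b hab => Subtype.ext (hinj hab))
  let h : (G →₀ V₀) →ₗ[ℚ] (G →₀ V₀) :=
    Finsupp.mapRange.linearMap r ∘ₗ f ∘ₗ Finsupp.mapRange.linearMap V₀.subtype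
  obtain ⟨x₀, hx₀⟩ : ∃ x₀ : G →₀ V₀, Finsupp.mapRange.linearMap V₀.subtype x₀ = x := by
    refine ⟨Finsupp.onFinset x.support (fun g => if hg : x g ∈ V₀ then ⟨x g, hg⟩ else 0) ?_, ?_⟩
    · intro g hg
      rw [Finsupp.mem_support_iff]
      intro h0
      apply hg
      simp [h0]
    · ext g
      have : x g ∈ V₀ := by
        by_cases hg : g ∈ x.support
        · exact Submodule.subset_span (Finset.mem_coe.2 (Finset.mem_image_of_mem x hg))
        · rw [Finsupp.notMem_support_iff.1 hg]; exact V₀.zero_mem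
      simp [this]
  have hhx : h x₀ = 0 := by simp only [h, LinearMap.comp_apply, hx₀, hx, map_zero]
  let b := Module.finBasis ℚ V₀
  let Y : ∀ _ : Fin _, (G →₀ V₀) →ₗ[ℚ] MonoidAlgebra ℚ G := fun i =>
    (MonoidAlgebra.coeffLinearEquiv ℚ).symm.toLinearMap ∘ₗ Finsupp.mapRange.linearMap (b.coord i)
  have hY : ∀ i g v, Y i (.single g v) = .single g (b.coord i v) := by
    intro i g v
    simp only [Y, LinearMap.comp_apply, Finsupp.mapRange.linearMap_apply, Finsupp.mapRange_single]
    rfl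
  have hYmul : ∀ i g z, Y i (z.mapDomain (· * g)) = Y i z * .single g 1 := by
    intro i g z
    induction z using Finsupp.induction_linear with
    | zero => simp
    | add x y hx hy => simp [Finsupp.mapDomain_add, hx, hy, add_mul]
    | single g v => simp [hY, MonoidAlgebra.single_mul_single]
  have hYaug : ∀ i z, augmentation G (Y i z) = b.coord i (coeffSum G V₀ z) := by
    intro i z
    induction z using Finsupp.induction_linear with
    | zero => simp
    | add x y hx hy => simp_all
    | single g v => simp [hY]
  let M : Matrix (Fin _) (Fin _) (MonoidAlgebra ℚ G) := fun j i => Y j (h (.single 1 (b i)))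
  have hbar : ∀ v, coeffSum G V₀ (h (.single 1 v)) = v := by
    intro v
    have h1 : ∀ z, coeffSum G V₀ (Finsupp.mapRange.linearMap r z) = r (coeffSum G W z) := by
      intro z
      induction z using Finsupp.induction_linear with
      | zero => simp
      | add x y hx hy => simp only [map_add, hx, hy]
      | single g v => simp
    have := LinearMap.congr_fun hr v
    simp only [h, LinearMap.comp_apply, h1]
    simpa [fbar] using this
  have hdet : M.det ≠ 0 := by
    have hM : (augmentation G : MonoidAlgebra ℚ G →+* ℚ).mapMatrix M = 1 := by
      ext i j
      refine (hYaug _ _).trans ?_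
      rw [hbar]
      simp [Matrix.one_apply, Finsupp.single_apply, eq_comm]
    intro h0
    have := RingHom.map_det (augmentation G : MonoidAlgebra ℚ G →+* ℚ) M
    rw [hM, h0] at this
    simp at this
  have hmul : ∀ z j, Y j (h z) = (M.mulVec fun i => Y i z) j := by
    intro z j
    induction z using Finsupp.induction_linear with
    | zero => simp [Matrix.mulVec, dotProduct]
    | add x y hx hy =>
      simp only [map_add, hx, hy]
      exact (congrFun (Matrix.mulVec_add M _ _) j).symm
    | single g v =>
      have heq : h (.single g v) = (h (.single 1 v)).mapDomain (· * g) := by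
        simp only [h, LinearMap.comp_apply, Finsupp.mapRange.linearMap_apply,
          Finsupp.mapRange_single]
        rw [hf.apply_single, Finsupp.mapDomain_mapRange]
        exact map_add r
      have hv : Y j (h (.single 1 v)) = ∑ i, b.coord i v • M j i := by
        conv_lhs => rw [← b.sum_repr v]
        have := map_sum (Y j ∘ₗ h ∘ₗ Finsupp.lsingle 1) (fun i => b.repr v i • b i) Finset.univ
        simp only [LinearMap.comp_apply, Finsupp.lsingle_apply, map_smul] at this
        exact this
      rw [heq, hYmul, hv, Matrix.mulVec, dotProduct, Finset.sum_mul]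
      refine Finset.sum_congr rfl fun i _ => ?_
      rw [hY, smul_mul_assoc, ← mul_smul_comm, MonoidAlgebra.smul_single, smul_eq_mul, mul_one]
  have hy0 := Matrix.eq_zero_of_mulVec_eq_zero hdet (v := fun i => Y i x₀) <| by
    ext1 j
    rw [← hmul, hhx, map_zero]; rfl
  have : x₀ = 0 := by
    ext1 g
    refine b.ext_elem fun i => ?_
    have := congrArg (fun z => z.coeff g) (congrFun hy0 i)
    simpa [Y] using this
  rw [← hx₀, this, map_zero]

theorem IsPTFA.strebelCondition {G : Type} [Group G] (hG : IsPTFA G) : StrebelCondition G :=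
  hG.induction (P := fun G _ => StrebelCondition G) (fun G _ _ => .of_subsingleton G)
    fun _ _ Q _ _ _ _ S hN => .of_extension S hN (.of_isMulTorsionFree Q)

end Strebel

/-! ### Change of coefficients and skew fields of fractions -/

section RightComb

open MulOpposite

/-- The linear combination `∑ i, J i * x i` with coefficients on the right, as a homomorphism of
right `S`-modules from the free module on `I`; right modules are modules over `Sᵐᵒᵖ`. -/
noncomputable def rightComb {S I N : Type*} [Ring S] [AddCommGroup N] [Module Sᵐᵒᵖ N] (J : I → N) :
    (I →₀ S) →ₗ[Sᵐᵒᵖ] N :=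
  Finsupp.lsum ℕ fun i =>
    { toFun := fun s => op s • J i
      map_add' := fun s t => by rw [MulOpposite.op_add, add_smul]
      map_smul' := fun c s => by
        rw [RingHom.id_apply, smul_smul]; rfl }

section

variable {S S' I α N : Type*} [Ring S] [Ring S'] [AddCommGroup N] [Module Sᵐᵒᵖ N]

@[simp] lemma rightComb_single (J : I → N) (i : I) (s : S) :
    rightComb J (.single i s) = op s • J i := by
  simp [rightComb]

lemma rightComb_eq_sum [Fintype I] (J : I → N) (x : I →₀ S) :
    rightComb J x = ∑ i, op (x i) • J i := by
  simp only [rightComb, Finsupp.lsum_apply]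
  exact Finsupp.sum_fintype _ _ fun i => by simp

lemma Finsupp.op_smul_single_one (i : I) (s : S) :
    op s • (Finsupp.single i (1 : S)) = .single i s := by
  simp

/-- Homomorphisms of right `S`-modules out of `I →₀ S` are determined on the basis. -/
lemma rightLinear_ext {f g : (I →₀ S) →ₗ[Sᵐᵒᵖ] N} (h : ∀ i, f (.single i 1) = g (.single i 1)) :
    f = g := by
  refine Finsupp.lhom_ext fun i s => ?_
  rw [← Finsupp.op_smul_single_one, map_smul, map_smul, h]

lemma eq_rightComb (f : (I →₀ S) →ₗ[Sᵐᵒᵖ] N) : f = rightComb fun i => f (.single i 1) :=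
  rightLinear_ext fun i => by simp

lemma map_rightComb {N' : Type*} [AddCommGroup N'] [Module Sᵐᵒᵖ N'] (f : N →ₗ[Sᵐᵒᵖ] N')
    (J : I → N) (x : I →₀ S) : f (rightComb J x) = rightComb (fun i => f (J i)) x := by
  suffices f ∘ₗ rightComb J = rightComb fun i => f (J i) from LinearMap.congr_fun this x
  exact rightLinear_ext fun i => by simp

/-- Change of coefficients along a ring homomorphism. -/
noncomputable def coeffMap (θ : S →+* S') : (α →₀ S) →+ (α →₀ S') :=
  Finsupp.mapRange.addMonoidHom θ.toAddMonoidHom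

@[simp] lemma coeffMap_single (θ : S →+* S') (a : α) (s : S) :
    coeffMap θ (.single a s) = .single a (θ s) := by
  simp [coeffMap]

@[simp] lemma coeffMap_apply (θ : S →+* S') (x : α →₀ S) (a : α) : coeffMap θ x a = θ (x a) := rfl

lemma coeffMap_op_smul (θ : S →+* S') (s : S) (x : α →₀ S) :
    coeffMap θ (op s • x) = op (θ s) • coeffMap θ x := by
  ext a; simp

lemma coeffMap_mapDomain {β : Type*} (θ : S →+* S') (f : α → β) (x : α →₀ S) :
    coeffMap θ (x.mapDomain f) = (coeffMap θ x).mapDomain f := by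
  induction x using Finsupp.induction_linear with
  | zero => simp
  | add x y hx hy => simp [Finsupp.mapDomain_add, hx, hy]
  | single a s => simp

lemma coeffMap_coeffMap {S'' : Type*} [Ring S''] (θ : S →+* S') (θ' : S' →+* S'') (x : α →₀ S) :
    coeffMap θ' (coeffMap θ x) = coeffMap (θ'.comp θ) x := by
  ext; simp

lemma coeffMap_injective {θ : S →+* S'} (hθ : Function.Injective θ) :
    Function.Injective (coeffMap θ : (α →₀ S) →+ (α →₀ S')) :=
  Finsupp.mapRange_injective _ (map_zero θ) hθ

lemma coeffMap_rightComb (θ : S →+* S') (J : I → α →₀ S) (x : I →₀ S) :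
    coeffMap θ (rightComb J x) = rightComb (fun i => coeffMap θ (J i)) (coeffMap θ x) := by
  induction x using Finsupp.induction_linear with
  | zero => simp
  | add x y hx hy => simp [hx, hy]
  | single i s => simp [coeffMap_op_smul]

/-- The elements with coefficients in a two-sided ideal are preserved by homomorphisms of right
modules between free modules. -/
lemma coeffMap_apply_eq_zero (θ : S →+* S') (f : (I →₀ S) →ₗ[Sᵐᵒᵖ] (α →₀ S)) {x : I →₀ S}
    (hx : coeffMap θ x = 0) : coeffMap θ (f x) = 0 := by
  rw [eq_rightComb f, coeffMap_rightComb, hx, map_zero]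

end

lemma rightComb_rat_eq {I N : Type*} [AddCommGroup N] [Module ℚ N] [Module ℚᵐᵒᵖ N]
    [IsCentralScalar ℚ N] (J : I → N) (x : I →₀ ℚ) :
    rightComb J x = Finsupp.linearCombination ℚ J x := by
  induction x using Finsupp.induction_linear with
  | zero => simp
  | add x y hx hy => simp [hx, hy]
  | single i s => simp [op_smul_eq_smul]

lemma rightComb_rat_injective_iff {I N : Type*} [AddCommGroup N] [Module ℚ N] [Module ℚᵐᵒᵖ N]
    [IsCentralScalar ℚ N] {J : I → N} :
    Function.Injective (rightComb (S := ℚ) J) ↔ LinearIndependent ℚ J := by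
  have : (rightComb (S := ℚ) J : (I →₀ ℚ) → N) = Finsupp.linearCombination ℚ J :=
    funext (rightComb_rat_eq J)
  rw [this]; rfl

end RightComb

section GroupRingIndependence

open MulOpposite

variable {G I α : Type} [Group G]

/-- The free right `ℚ[G]`-module on `I`, as the module of finitely supported functions on `G` with
values in `I →₀ ℚ`. -/
noncomputable def freeModuleEquiv (G I : Type) [Group G] :
    (G →₀ I →₀ ℚ) ≃ₗ[ℚ] (I →₀ MonoidAlgebra ℚ G) :=
  (Finsupp.curryLinearEquiv ℚ).symm ≪≫ₗ Finsupp.domLCongr (Equiv.prodComm G I) ≪≫ₗ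
    Finsupp.curryLinearEquiv ℚ ≪≫ₗ
      Finsupp.mapRange.linearEquiv (MonoidAlgebra.coeffLinearEquiv ℚ).symm

@[simp] lemma freeModuleEquiv_single (g : G) (i : I) (q : ℚ) :
    freeModuleEquiv G I (.single g (.single i q)) = .single i (.single g q) := by
  simp [freeModuleEquiv]

lemma freeModuleEquiv_mapDomain (g : G) (x : G →₀ I →₀ ℚ) :
    freeModuleEquiv G I (x.mapDomain (· * g)) =
      op (MonoidAlgebra.single g (1 : ℚ)) • freeModuleEquiv G I x := by
  induction x using Finsupp.induction_linear with
  | zero => simp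
  | add x y hx hy => simp [Finsupp.mapDomain_add, hx, hy]
  | single m u =>
    induction u using Finsupp.induction_linear with
    | zero => simp
    | add x y hx hy =>
      simp only [Finsupp.single_add, Finsupp.mapDomain_add, hx, hy, map_add, smul_add]
    | single q v => simp [MonoidAlgebra.single_mul_single]

lemma coeffMap_augmentation_freeModuleEquiv (x : G →₀ I →₀ ℚ) :
    coeffMap (augmentation G : MonoidAlgebra ℚ G →+* ℚ) (freeModuleEquiv G I x) =
      coeffSum G _ x := by
  induction x using Finsupp.induction_linear with
  | zero => simp
  | add x y hx hy => simp [hx, hy]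
  | single m u =>
    induction u using Finsupp.induction_linear with
    | zero => simp
    | add x y hx hy => simp_all only [Finsupp.single_add, map_add]
    | single q v => simp

/-- Strebel's condition in terms of vectors over the group ring. -/
theorem StrebelCondition.rightComb_injective (hG : StrebelCondition G)
    (C : I → α →₀ MonoidAlgebra ℚ G)
    (hC : LinearIndependent ℚ
      fun i => coeffMap (augmentation G : MonoidAlgebra ℚ G →+* ℚ) (C i)) :
    Function.Injective (rightComb (S := MonoidAlgebra ℚ G) C) := by
  let f : (G →₀ I →₀ ℚ) →ₗ[ℚ] (G →₀ α →₀ ℚ) :=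
    (freeModuleEquiv G α).symm.toLinearMap ∘ₗ
      (rightComb C).toAddMonoidHom.toRatLinearMap ∘ₗ (freeModuleEquiv G I).toLinearMap
  have hf : ∀ x, freeModuleEquiv G α (f x) = rightComb C (freeModuleEquiv G I x) := fun x => by
    simp [f]
  have := hG _ _ f ?_ ?_
  · intro x y hxy
    obtain ⟨x, rfl⟩ := (freeModuleEquiv G I).surjective x
    obtain ⟨y, rfl⟩ := (freeModuleEquiv G I).surjective y
    rw [← hf, ← hf] at hxy
    rw [this ((freeModuleEquiv G α).injective hxy)]
  · intro g x
    apply (freeModuleEquiv G α).injective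
    rw [hf, freeModuleEquiv_mapDomain, map_smul, freeModuleEquiv_mapDomain, hf]
  · convert rightComb_rat_injective_iff.2 hC using 2 with v
    rw [← coeffMap_augmentation_freeModuleEquiv, hf, coeffMap_rightComb,
      coeffMap_augmentation_freeModuleEquiv, coeffSum_single]

end GroupRingIndependence

section FractionField

open MulOpposite

theorem IsRightFractionField.exists_common_denominator {R K I : Type} [Ring R] [DivisionRing K]
    {ι : R →+* K} (hι : IsRightFractionField ι) (x : I →₀ K) :
    ∃ (s : R) (y : I →₀ R), s ≠ 0 ∧ op (ι s) • x = coeffMap ι y := by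
  have : Nontrivial R := ι.domain_nontrivial
  have hne : ∀ {s}, s ≠ 0 → ι s ≠ 0 := fun h => (map_ne_zero_iff ι hι.injective).2 h
  induction x using Finsupp.induction_linear with
  | zero => exact ⟨1, 0, one_ne_zero, by simp⟩
  | add x y hx hy =>
    obtain ⟨s, x', hs, hx'⟩ := hx
    obtain ⟨t, y', ht, hy'⟩ := hy
    -- a common right multiple of `s` and `t`
    obtain ⟨u, v, hv, huv⟩ := hι.exists_eq ((ι s)⁻¹ * ι t)
    have h : ι (t * v) = ι (s * u) := by
      rw [map_mul, map_mul]
      rw [eq_mul_inv_iff_mul_eq₀ (hne hv), mul_assoc, inv_mul_eq_iff_eq_mul₀ (hne hs)] at huv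
      exact huv
    refine ⟨t * v, op u • x' + op v • y', ?_, ?_⟩
    · intro h0
      have : ι t * ι v = 0 := by rw [← map_mul, h0, map_zero]
      exact (mul_ne_zero (hne ht) (hne hv)) this
    · rw [map_add, coeffMap_op_smul, coeffMap_op_smul, ← hx', ← hy', smul_smul, smul_smul, smul_add,
        ← op_mul, ← op_mul, ← map_mul, ← map_mul, h]
  | single i k =>
    obtain ⟨r, s, hs, rfl⟩ := hι.exists_eq k
    exact ⟨s, .single i r, hs, by
      rw [Finsupp.smul_single, op_smul_eq_mul, mul_assoc, inv_mul_cancel₀ (hne hs), mul_one,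
        coeffMap_single]⟩

theorem IsRightFractionField.rightComb_injective {R K I α : Type} [Ring R] [DivisionRing K]
    {ι : R →+* K} (hι : IsRightFractionField ι) {C : I → α →₀ R}
    (hC : Function.Injective (rightComb (S := R) C)) :
    Function.Injective (rightComb (S := K) fun i => coeffMap ι (C i)) := by
  rw [← LinearMap.ker_eq_bot, LinearMap.ker_eq_bot']
  intro x hx
  obtain ⟨s, y, hs, hy⟩ := hι.exists_common_denominator x
  have h : coeffMap ι (rightComb C y) = 0 := by
    rw [coeffMap_rightComb, ← hy, map_smul, hx, smul_zero]
  rw [← map_zero (coeffMap ι)] at h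
  have h := coeffMap_injective hι.injective h
  rw [← map_zero (rightComb (S := R) C)] at h
  rw [hC h, map_zero] at hy
  ext i
  have := DFunLike.congr_fun hy i
  simpa [(map_ne_zero_iff ι hι.injective).2 hs] using this

/-- A domain satisfying the right Ore condition has a skew field of right fractions. As Mathlib's
Ore localization consists of left fractions, it is applied to the opposite ring. -/
theorem exists_isRightFractionField {R : Type} [Ring R] [Nontrivial R] [NoZeroDivisors R]
    (hR : ∀ r s : R, s ≠ 0 → ∃ r' s' : R, s' ≠ 0 ∧ r * s' = s * r') :
    ∃ (K : Type) (_ : DivisionRing K) (ι : R →+* K), IsRightFractionField ι := by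
  have hore : Nonempty (OreLocalization.OreSet (nonZeroDivisors Rᵐᵒᵖ)) := by
    rw [OreLocalization.nonempty_oreSet_iff_of_noZeroDivisors]
    intro r s
    obtain ⟨r', s', hs', h⟩ := hR r.unop s.1.unop
      (by simp)
    exact ⟨op r', ⟨op s', mem_nonZeroDivisors_of_ne_zero (by simpa using hs')⟩,
      unop_injective h⟩
  obtain ⟨_⟩ := hore
  let L := OreLocalization (nonZeroDivisors Rᵐᵒᵖ) Rᵐᵒᵖ
  let ν : Rᵐᵒᵖ →+* L := OreLocalization.numeratorRingHom
  have hν : Function.Injective ν := OreLocalization.numeratorHom_inj fun x hx => hx.1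
  let ι : R →+* Lᵐᵒᵖ := (RingHom.op ν).comp (RingEquiv.opOp R).toRingHom
  have hι : ∀ r, ι r = op (ν (op r)) := fun r => rfl
  refine ⟨Lᵐᵒᵖ, inferInstance, ι, fun x y h => ?_, fun x => ?_⟩
  · exact op_injective (hν (op_injective h))
  · obtain ⟨x, rfl⟩ := op_surjective x
    induction x using OreLocalization.ind with | _ r s
    refine ⟨r.unop, s.1.unop, by simp, ?_⟩
    have hs : ν s.1 ≠ 0 := (map_ne_zero_iff ν hν).2 (nonZeroDivisors.ne_zero s.2)
    rw [hι, hι, op_unop, op_unop, ← MulOpposite.op_inv, ← MulOpposite.op_mul]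
    congr 1
    rw [eq_inv_mul_iff_mul_eq₀ hs]
    exact OreLocalization.mul_cancel

end FractionField

section PTFAGroupRing

open MulOpposite

/-- The right Ore condition: the map `ℚ[G]² → ℚ[G]` given by `r` and `-s` has a kernel. -/
theorem HomRankCondition.exists_mul_eq_mul {G : Type} [Group G] (hG : HomRankCondition G)
    [NoZeroDivisors (MonoidAlgebra ℚ G)] (r s : MonoidAlgebra ℚ G) (hs : s ≠ 0) :
    ∃ r' s' : MonoidAlgebra ℚ G, s' ≠ 0 ∧ r * s' = s * r' := by
  let C : Fin 2 → Unit →₀ MonoidAlgebra ℚ G := fun i => .single () (![r, -s] i)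
  let f : (G →₀ Fin 2 →₀ ℚ) →ₗ[ℚ] (G →₀ Unit →₀ ℚ) :=
    (freeModuleEquiv G Unit).symm.toLinearMap ∘ₗ
      (rightComb C).toAddMonoidHom.toRatLinearMap ∘ₗ (freeModuleEquiv G (Fin 2)).toLinearMap
  have hf : ∀ x, freeModuleEquiv G Unit (f x) = rightComb C (freeModuleEquiv G (Fin 2) x) :=
    fun x => by simp [f]
  have := hG _ _ f (fun g x => (freeModuleEquiv G Unit).injective <| by
    rw [hf, freeModuleEquiv_mapDomain, map_smul, freeModuleEquiv_mapDomain, hf]) (by simp)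
  rw [← LinearMap.ker_eq_bot, LinearMap.ker_eq_bot'] at this
  push Not at this
  obtain ⟨x, hx, hx0⟩ := this
  set y := freeModuleEquiv G (Fin 2) x with hy
  have h : r * y 0 - s * y 1 = 0 := by
    have h1 := hf x
    rw [hx, map_zero, rightComb_eq_sum] at h1
    have := DFunLike.congr_fun h1 ()
    simpa [C, sub_eq_add_neg] using this.symm
  rw [sub_eq_zero] at h
  refine ⟨y 1, y 0, fun h0 => hx0 ?_, h⟩
  rw [h0, mul_zero, eq_comm, mul_eq_zero] at h
  have h1 := h.resolve_left hs
  rw [← (freeModuleEquiv G (Fin 2)).map_eq_zero_iff, ← hy]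
  ext1 i
  fin_cases i
  · exact h0
  · exact h1

theorem IsPTFA.exists_isRightFractionField {G : Type} [Group G] (hG : IsPTFA G) :
    ∃ (K : Type) (_ : DivisionRing K) (_ : Algebra ℚ K) (ι : MonoidAlgebra ℚ G →ₐ[ℚ] K),
      IsRightFractionField (ι : MonoidAlgebra ℚ G →+* K) := by
  have := hG.uniqueProds
  obtain ⟨K, _, ι, hι⟩ := _root_.exists_isRightFractionField hG.homRankCondition.exists_mul_eq_mul
  have : CharZero (MonoidAlgebra ℚ G) := algebraRat.charZero _
  have : CharZero K := charZero_of_injective_ringHom hι.injective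
  exact ⟨K, _, DivisionRing.toRatAlgebra, ι.toRatAlgHom, hι⟩

end PTFAGroupRing

/-! ### Inhomogeneous chains and Fox derivatives -/

section BarChains

open MulOpposite

variable {S : Type*} [Ring S] {G H : Type*} [Group G] [Group H]

/-- The differential `C₁ → C₀` of the inhomogeneous chain complex of `G` with coefficients in `S`,
on which `g` acts as left multiplication by `ρ g`. -/
noncomputable def barD₁ (ρ : G →* S) : (G →₀ S) →ₗ[Sᵐᵒᵖ] S :=
  rightComb fun g => ρ g⁻¹ - 1

/-- The differential `C₂ → C₁` of the inhomogeneous chain complex of `G` with coefficients in `S`,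
on which `g` acts as left multiplication by `ρ g`. -/
noncomputable def barD₂ (ρ : G →* S) : (G × G →₀ S) →ₗ[Sᵐᵒᵖ] (G →₀ S) :=
  rightComb fun g => .single g.2 (ρ g.1⁻¹) - .single (g.1 * g.2) 1 + .single g.1 1

/-- The differential `C₃ → C₂` of the inhomogeneous chain complex of `G` with coefficients in `S`,
on which `g` acts as left multiplication by `ρ g`. -/
noncomputable def barD₃ (ρ : G →* S) : (G × G × G →₀ S) →ₗ[Sᵐᵒᵖ] (G × G →₀ S) :=
  rightComb fun g => .single (g.2.1, g.2.2) (ρ g.1⁻¹) - .single (g.1 * g.2.1, g.2.2) 1 +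
    .single (g.1, g.2.1 * g.2.2) 1 - .single (g.1, g.2.1) 1

variable (ρ : G →* S)

lemma barD₁_single (g : G) (s : S) : barD₁ ρ (.single g s) = ρ g⁻¹ * s - s := by
  simp [barD₁, sub_mul]

lemma barD₂_single (g h : G) (s : S) : barD₂ ρ (.single (g, h) s) =
    .single h (ρ g⁻¹ * s) - .single (g * h) s + .single g s := by
  simp [barD₂, smul_add, smul_sub]

lemma barD₃_single (g h k : G) (s : S) : barD₃ ρ (.single (g, h, k) s) =
    .single (h, k) (ρ g⁻¹ * s) - .single (g * h, k) s + .single (g, h * k) s -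
      .single (g, h) s := by
  simp [barD₃, smul_add, smul_sub]

lemma barD₁_barD₂ (x : G × G →₀ S) : barD₁ ρ (barD₂ ρ x) = 0 := by
  induction x using Finsupp.induction_linear with
  | zero => simp
  | add x y hx hy => simp [hx, hy]
  | single g s =>
    obtain ⟨g, h⟩ := g
    simp only [barD₂_single, map_add, map_sub, barD₁_single, mul_inv_rev, map_mul, mul_assoc]
    abel

lemma barD₂_barD₃ (x : G × G × G →₀ S) : barD₂ ρ (barD₃ ρ x) = 0 := by
  induction x using Finsupp.induction_linear with
  | zero => simp
  | add x y hx hy => simp [hx, hy]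
  | single g s =>
    obtain ⟨g, h, k⟩ := g
    simp only [barD₃_single, map_add, map_sub, barD₂_single, mul_inv_rev, map_mul, mul_assoc]
    abel

lemma barD₁_mapDomain (f : H →* G) (x : H →₀ S) :
    barD₁ ρ (x.mapDomain f) = barD₁ (ρ.comp f) x := by
  induction x using Finsupp.induction_linear with
  | zero => simp
  | add x y hx hy => simp [Finsupp.mapDomain_add, hx, hy]
  | single g s => simp [barD₁_single]

lemma barD₂_mapDomain (f : H →* G) (x : H × H →₀ S) :
    barD₂ ρ (x.mapDomain (Prod.map f f)) = (barD₂ (ρ.comp f) x).mapDomain f := by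
  induction x using Finsupp.induction_linear with
  | zero => simp
  | add x y hx hy => simp [Finsupp.mapDomain_add, hx, hy]
  | single g s =>
    obtain ⟨g, h⟩ := g
    rw [Finsupp.mapDomain_single, Prod.map_apply, barD₂_single, barD₂_single,
      Finsupp.mapDomain_add, Finsupp.mapDomain_single,
      ← Finsupp.lmapDomain_apply S ℕ f (_ - _), map_sub]
    simp [-Finsupp.single_mul]

variable {S' : Type*} [Ring S']

lemma coeffMap_barD₂ (θ : S →+* S') (x : G × G →₀ S) :
    coeffMap θ (barD₂ ρ x) = barD₂ ((θ : S →* S').comp ρ) (coeffMap θ x) := by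
  induction x using Finsupp.induction_linear with
  | zero => simp
  | add x y hx hy => simp [hx, hy]
  | single g s => obtain ⟨g, h⟩ := g; simp [barD₂_single, -Finsupp.single_mul]

lemma coeffMap_barD₃ (θ : S →+* S') (x : G × G × G →₀ S) :
    coeffMap θ (barD₃ ρ x) = barD₃ ((θ : S →* S').comp ρ) (coeffMap θ x) := by
  induction x using Finsupp.induction_linear with
  | zero => simp
  | add x y hx hy => simp [hx, hy]
  | single g s => obtain ⟨g, h, k⟩ := g; simp [barD₃_single, -Finsupp.single_mul]

lemma lmapDomain_sub {I J : Type*} (f : I → J) (x y : I →₀ S) :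
    (x - y).mapDomain f = x.mapDomain f - y.mapDomain f :=
  map_sub (Finsupp.lmapDomain S ℕ f) x y

end BarChains

section Generation

open MulOpposite

variable {S : Type*} [Ring S] {G : Type*} [Group G] {ρ : G →* S}

/-- Homomorphisms of right modules out of a free module can be lifted through a sum of two maps. -/
lemma exists_rightLinear_lift {I M₁ M₂ N : Type*} [AddCommGroup M₁] [Module Sᵐᵒᵖ M₁]
    [AddCommGroup M₂] [Module Sᵐᵒᵖ M₂] [AddCommGroup N] [Module Sᵐᵒᵖ N]
    (T : (I →₀ S) →ₗ[Sᵐᵒᵖ] N) (f : M₁ →ₗ[Sᵐᵒᵖ] N) (g : M₂ →ₗ[Sᵐᵒᵖ] N)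
    (h : ∀ i, T (.single i 1) ∈ LinearMap.range f ⊔ LinearMap.range g) :
    ∃ (Y : (I →₀ S) →ₗ[Sᵐᵒᵖ] M₁) (V : (I →₀ S) →ₗ[Sᵐᵒᵖ] M₂), ∀ c, T c = f (Y c) + g (V c) := by
  have h' : ∀ i, ∃ y v, T (.single i 1) = f y + g v := fun i => by
    obtain ⟨_, ⟨y, rfl⟩, _, ⟨v, rfl⟩, hyv⟩ := Submodule.mem_sup.1 (h i)
    exact ⟨y, v, hyv.symm⟩
  choose y v hyv using h'
  refine ⟨rightComb y, rightComb v, fun c => ?_⟩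
  suffices T = f ∘ₗ rightComb y + g ∘ₗ rightComb v from LinearMap.congr_fun this c
  exact rightLinear_ext fun i => by simp [hyv]

/-- In `C₁` modulo a submodule containing the boundaries, `[g h] = [g] + g⁻¹ [h]`. -/
lemma single_mul_sub_mem {N : Submodule Sᵐᵒᵖ (G →₀ S)} (hN : LinearMap.range (barD₂ ρ) ≤ N)
    (g h : G) :
    Finsupp.single (g * h) (1 : S) - (.single g 1 + op (ρ g⁻¹) • .single h 1) ∈ N := by
  have := N.neg_mem (hN ⟨.single (g, h) 1, rfl⟩)
  rw [barD₂_single] at this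
  convert this using 1
  simp
  abel

lemma single_one_mem_range_barD₂ (s : S) : Finsupp.single 1 s ∈ LinearMap.range (barD₂ ρ) :=
  ⟨.single (1, 1) s, by simp [barD₂_single]⟩

lemma single_mul_mem_iff {N : Submodule Sᵐᵒᵖ (G →₀ S)} (hN : LinearMap.range (barD₂ ρ) ≤ N)
    (g h : G) : Finsupp.single (g * h) (1 : S) ∈ N ↔
      .single g 1 + op (ρ g⁻¹) • Finsupp.single h (1 : S) ∈ N := by
  have := single_mul_sub_mem hN g h
  exact ⟨fun h => by simpa using N.sub_mem h this, fun h => by simpa using N.add_mem this h⟩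

/-- If `N` contains the boundaries then the `g` with `[g] ∈ N` form a subgroup. -/
lemma single_mem_of_mem_closure {N : Submodule Sᵐᵒᵖ (G →₀ S)}
    (hN : LinearMap.range (barD₂ ρ) ≤ N) {s : Set G} (hs : ∀ g ∈ s, Finsupp.single g (1 : S) ∈ N)
    {g : G} (hg : g ∈ Subgroup.closure s) : Finsupp.single g (1 : S) ∈ N := by
  induction hg using Subgroup.closure_induction with
  | mem g hg => exact hs g hg
  | one => exact hN (single_one_mem_range_barD₂ 1)
  | mul g h _ _ hg hh => exact (single_mul_mem_iff hN g h).2 (N.add_mem hg (N.smul_mem _ hh))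
  | inv g _ hg =>
    have h1 : Finsupp.single (g * g⁻¹) (1 : S) ∈ N := by
      rw [mul_inv_cancel]; exact hN (single_one_mem_range_barD₂ 1)
    have h2 := N.smul_mem (op (ρ g)) ((N.add_mem_iff_right hg).1 ((single_mul_mem_iff hN _ _).1 h1))
    rwa [smul_smul, ← MulOpposite.op_mul, ← map_mul, inv_mul_cancel, map_one, MulOpposite.op_one,
      one_smul] at h2

/-- If `a` generates `G`, every 1-chain is a combination of the chains `[a i]`, modulo boundaries.
The coefficients and the bounding 2-chain depend linearly on the chain. -/
theorem exists_barChain_generators {I : Type*} (a : I → G)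
    (ha : Subgroup.closure (Set.range a) = ⊤) (ρ : G →* S) :
    ∃ (P : (G →₀ S) →ₗ[Sᵐᵒᵖ] (I →₀ S)) (V : (G →₀ S) →ₗ[Sᵐᵒᵖ] (G × G →₀ S)),
      ∀ c, c = (P c).mapDomain a + barD₂ ρ (V c) :=
  exists_rightLinear_lift LinearMap.id (Finsupp.lmapDomain S Sᵐᵒᵖ a) (barD₂ ρ) fun g =>
    single_mem_of_mem_closure (s := Set.range a) le_sup_right
      (by rintro _ ⟨i, rfl⟩
          exact Submodule.mem_sup_left ⟨.single i 1, by simp⟩) (ha ▸ Subgroup.mem_top g)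

/-- Let `F → B` be a surjection whose kernel is the normal closure of the elements `r j`. A 1-chain
`c` of `F` whose image in `B` is the boundary of `e` is a combination of the chains `[r j]`, modulo
boundaries. The coefficients and the bounding 2-chain depend linearly on `c` and `e`. -/
theorem exists_barChain_relators {F B J : Type*} [Group F] [Group B] (π : F →* B)
    (hπ : Function.Surjective π) (r : J → F)
    (hr : π.ker = Subgroup.normalClosure (Set.range r)) (ρ : B →* S) :
    ∃ (Y : (F →₀ S) →ₗ[Sᵐᵒᵖ] (J →₀ S)) (V : (F →₀ S) →ₗ[Sᵐᵒᵖ] (F × F →₀ S))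
      (Y' : (B × B →₀ S) →ₗ[Sᵐᵒᵖ] (J →₀ S)) (V' : (B × B →₀ S) →ₗ[Sᵐᵒᵖ] (F × F →₀ S)),
      ∀ c e, c.mapDomain π = barD₂ ρ e →
        c = (Y c + Y' e).mapDomain r + barD₂ (ρ.comp π) (V c + V' e) := by
  set N := LinearMap.range (Finsupp.lmapDomain S Sᵐᵒᵖ r) ⊔ LinearMap.range (barD₂ (ρ.comp π))
    with hN
  have hle : LinearMap.range (barD₂ (ρ.comp π)) ≤ N := le_sup_right
  have hrN : ∀ j, Finsupp.single (r j) (1 : S) ∈ N := fun j =>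
    Submodule.mem_sup_left ⟨.single j 1, by simp⟩
  -- the kernel elements `k` with `[k] ∈ N` form a normal subgroup
  have hker : ∀ k ∈ π.ker, Finsupp.single k (1 : S) ∈ N := by
    intro k hk
    let K : Subgroup F :=
      { carrier := {k | π k = 1 ∧ Finsupp.single k (1 : S) ∈ N}
        one_mem' := ⟨map_one π, hle (single_one_mem_range_barD₂ 1)⟩
        mul_mem' := fun {g h} hg hh => ⟨by rw [map_mul, hg.1, hh.1, one_mul],
          (single_mul_mem_iff hle g h).2 (N.add_mem hg.2 (N.smul_mem _ hh.2))⟩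
        inv_mem' := fun {g} hg => ⟨by rw [map_inv, hg.1, inv_one],
          single_mem_of_mem_closure (s := {g}) hle (by rintro _ rfl; exact hg.2)
            (Subgroup.inv_mem _ (Subgroup.subset_closure rfl))⟩ }
    have hK : K.Normal := ⟨fun k hk g => ⟨by simp [hk.1], by
      have h1 : Finsupp.single (g * g⁻¹) (1 : S) ∈ N := by
        rw [mul_inv_cancel]; exact hle (single_one_mem_range_barD₂ 1)
      rw [single_mul_mem_iff hle] at h1
      have h2 := single_mul_sub_mem hle k g⁻¹
      rw [mul_assoc, single_mul_mem_iff hle]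
      have h3 := N.add_mem h1 (N.smul_mem (op ((ρ.comp π) g⁻¹)) (N.add_mem h2 hk.2))
      convert h3 using 1
      have : (ρ.comp π) k⁻¹ = 1 := by simp [hk.1]
      rw [this, MulOpposite.op_one, one_smul, ← sub_sub, sub_right_comm, sub_add_cancel, smul_sub]
      abel⟩⟩
    have : Subgroup.normalClosure (Set.range r) ≤ K := Subgroup.normalClosure_le_normal <| by
      rintro _ ⟨j, rfl⟩
      refine ⟨?_, hrN j⟩
      rw [← MonoidHom.mem_ker, hr]
      exact Subgroup.subset_normalClosure ⟨j, rfl⟩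
    exact (this (hr ▸ hk)).2
  have hmul : ∀ g k, π k = 1 →
      Finsupp.single (g * k) (1 : S) - .single g 1 ∈ N := by
    intro g k hk
    have := N.add_mem (single_mul_sub_mem hle g k) (N.smul_mem (op ((ρ.comp π) g⁻¹)) (hker k hk))
    convert this using 1
    abel
  let σ : B → F := Function.surjInv hπ
  have hσ : ∀ b, π (σ b) = b := Function.surjInv_eq hπ
  have hcong : ∀ g h, π g = π h → Finsupp.single g (1 : S) - .single h 1 ∈ N := by
    intro g h hgh
    have := hmul h (h⁻¹ * g) (by simp [hgh])
    rwa [mul_inv_cancel_left] at this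
  obtain ⟨Y, V, h⟩ := exists_rightLinear_lift
    (LinearMap.id - Finsupp.lmapDomain S Sᵐᵒᵖ σ ∘ₗ Finsupp.lmapDomain S Sᵐᵒᵖ π)
    (Finsupp.lmapDomain S Sᵐᵒᵖ r) (barD₂ (ρ.comp π)) fun g => by
      simpa using hcong g (σ (π g)) (by rw [hσ])
  obtain ⟨Y', V', h'⟩ := exists_rightLinear_lift
    (Finsupp.lmapDomain S Sᵐᵒᵖ σ ∘ₗ barD₂ ρ)
    (Finsupp.lmapDomain S Sᵐᵒᵖ r) (barD₂ (ρ.comp π)) fun ⟨g, h⟩ => by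
      have h1 := N.neg_mem (hcong (σ g * σ h) (σ (g * h)) (by simp [hσ]))
      have h2 := single_mul_sub_mem hle (σ g) (σ h)
      have h3 := N.neg_mem (N.sub_mem h2 (N.neg_mem h1))
      rw [LinearMap.comp_apply, barD₂_single, map_add, map_sub]
      convert h3 using 1
      simp [hσ, -Finsupp.single_mul]
      abel
  refine ⟨Y, V, Y', V', fun c e hce => ?_⟩
  have h1 := h c
  have h2 := h' e
  simp only [LinearMap.sub_apply, LinearMap.id_apply, LinearMap.comp_apply,
    Finsupp.lmapDomain_apply, hce] at h1 h2
  rw [sub_eq_iff_eq_add, h2] at h1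
  conv_lhs => rw [h1]
  rw [Finsupp.mapDomain_add, map_add]
  abel

end Generation

section Fox

open MulOpposite

variable {S : Type*} [Ring S] {α : Type*}

/-- Left multiplication by a generator on Fox derivatives: `m ↦ [a] + a⁻¹ m`, with `m` written as a
right-hand coefficient. -/
noncomputable def foxPerm (ρ : FreeGroup α →* S) (a : α) : Equiv.Perm (α →₀ S) where
  toFun m := .single a 1 + op (ρ (.of a)⁻¹) • m
  invFun m := op (ρ (.of a)) • (m - .single a 1)
  left_inv m := by
    simp only [add_sub_cancel_left, smul_smul, ← MulOpposite.op_mul, ← map_mul, inv_mul_cancel,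
      map_one, MulOpposite.op_one, one_smul]
  right_inv m := by
    simp only [smul_smul, ← MulOpposite.op_mul, ← map_mul, mul_inv_cancel, map_one,
      MulOpposite.op_one, one_smul, add_sub_cancel]

/-- The vector of Fox derivatives of a word, with coefficients pushed to `S` along `ρ`. In the
conventions of inhomogeneous chains it satisfies `D (u v) = D u + D v * u⁻¹`. -/
noncomputable def foxDerivative (ρ : FreeGroup α →* S) (w : FreeGroup α) : α →₀ S :=
  FreeGroup.lift (foxPerm ρ) w 0

lemma lift_foxPerm_apply (ρ : FreeGroup α →* S) (w : FreeGroup α) (m : α →₀ S) :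
    FreeGroup.lift (foxPerm ρ) w m = foxDerivative ρ w + op (ρ w⁻¹) • m := by
  induction w using FreeGroup.induction_on generalizing m with
  | C1 => simp [foxDerivative]
  | of a => simp [foxDerivative, foxPerm]
  | inv_of a _ =>
    have : ∀ m, FreeGroup.lift (foxPerm ρ) (FreeGroup.of a)⁻¹ m =
        op (ρ (.of a)) • (m - .single a 1) := fun m => by
      rw [map_inv, FreeGroup.lift_apply_of]; rfl
    rw [foxDerivative, this, this, inv_inv, ← smul_add]
    congr 1; abel
  | mul u v hu hv =>
    rw [foxDerivative, map_mul, Equiv.Perm.mul_apply, Equiv.Perm.mul_apply, hv, hv, hu, hu,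
      smul_zero, add_zero, smul_add, smul_smul, ← MulOpposite.op_mul, ← map_mul, mul_inv_rev,
      add_assoc]

lemma foxDerivative_mul (ρ : FreeGroup α →* S) (u v : FreeGroup α) :
    foxDerivative ρ (u * v) = foxDerivative ρ u + op (ρ u⁻¹) • foxDerivative ρ v := by
  rw [← lift_foxPerm_apply, foxDerivative, map_mul]; rfl

@[simp] lemma foxDerivative_of (ρ : FreeGroup α →* S) (a : α) :
    foxDerivative ρ (.of a) = .single a 1 := by
  simp [foxDerivative, foxPerm]

@[simp] lemma foxDerivative_one (ρ : FreeGroup α →* S) : foxDerivative ρ 1 = 0 := by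
  simp [foxDerivative]

lemma foxDerivative_inv_of (ρ : FreeGroup α →* S) (a : α) :
    foxDerivative ρ (FreeGroup.of a)⁻¹ = -.single a (ρ (.of a)) := by
  have := foxDerivative_mul ρ (.of a)⁻¹ (.of a)
  rw [inv_mul_cancel, foxDerivative_one, inv_inv, foxDerivative_of,
    Finsupp.op_smul_single_one] at this
  exact eq_neg_of_add_eq_zero_left this.symm

/-- The map `C₁(F; S) → α →₀ S` induced by Fox derivatives, for the free group `F` on `α`. It
identifies the 1-chains modulo boundaries with a free module. -/
noncomputable def foxChain (ρ : FreeGroup α →* S) : (FreeGroup α →₀ S) →ₗ[Sᵐᵒᵖ] (α →₀ S) :=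
  rightComb (foxDerivative ρ)

lemma foxChain_barD₂ (ρ : FreeGroup α →* S) (x : FreeGroup α × FreeGroup α →₀ S) :
    foxChain ρ (barD₂ ρ x) = 0 := by
  suffices foxChain ρ ∘ₗ barD₂ ρ = 0 from LinearMap.congr_fun this x
  refine rightLinear_ext fun ⟨u, v⟩ => ?_
  simp [barD₂_single, foxChain, foxDerivative_mul]

lemma foxChain_mapDomain_of (ρ : FreeGroup α →* S) (x : α →₀ S) :
    foxChain ρ (x.mapDomain FreeGroup.of) = x := by
  suffices foxChain ρ ∘ₗ Finsupp.lmapDomain S Sᵐᵒᵖ FreeGroup.of = LinearMap.id from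
    LinearMap.congr_fun this x
  exact rightLinear_ext fun a => by simp [foxChain]

lemma sub_mapDomain_foxChain_mem (ρ : FreeGroup α →* S) (c : FreeGroup α →₀ S) :
    c - (foxChain ρ c).mapDomain FreeGroup.of ∈ LinearMap.range (barD₂ ρ) := by
  obtain ⟨P, V, h⟩ := exists_barChain_generators (FreeGroup.of (α := α))
    (FreeGroup.closure_range_of α) ρ
  have hP : foxChain ρ c = P c := by
    conv_lhs => rw [h c]
    rw [map_add, foxChain_barD₂, foxChain_mapDomain_of, add_zero]
  refine ⟨V c, ?_⟩
  rw [hP, eq_sub_iff_add_eq, add_comm]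
  exact (h c).symm

lemma foxChain_eq_zero_iff {ρ : FreeGroup α →* S} {c : FreeGroup α →₀ S} :
    foxChain ρ c = 0 ↔ c ∈ LinearMap.range (barD₂ ρ) := by
  refine ⟨fun h => ?_, ?_⟩
  · have := sub_mapDomain_foxChain_mem ρ c
    rwa [h, Finsupp.mapDomain_zero, sub_zero] at this
  · rintro ⟨x, rfl⟩
    exact foxChain_barD₂ ρ x

lemma coeffMap_foxDerivative {S' : Type*} [Ring S'] (θ : S →+* S') (ρ : FreeGroup α →* S)
    (w : FreeGroup α) :
    coeffMap θ (foxDerivative ρ w) = foxDerivative ((θ : S →* S').comp ρ) w := by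
  induction w using FreeGroup.induction_on with
  | C1 => simp
  | of a => simp
  | inv_of a h => simp [foxDerivative_inv_of]
  | mul u v hu hv => simp [foxDerivative_mul, coeffMap_op_smul, hu, hv]

end Fox

/-! ### Ranks over `ℚ` and over a skew field, and lifts of rational relations -/

section LinearAlgebra

open MulOpposite

theorem rightLinear_surjective_of_injective {K I : Type} [DivisionRing K] [Finite I]
    {f : (I →₀ K) →ₗ[Kᵐᵒᵖ] (I →₀ K)} (hf : Function.Injective f) : Function.Surjective f := by
  have : Module.Finite Kᵐᵒᵖ K :=
    Module.Finite.of_surjective (LinearMap.toSpanSingleton Kᵐᵒᵖ K 1) fun x => ⟨op x, by simp⟩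
  exact LinearMap.surjective_of_injective hf

/-- A ring `R` augmented over `ℚ` and a homomorphism `ι` to a skew field satisfy the independence
condition if families of vectors over `R` that are linearly independent after augmentation are
linearly independent over the skew field. -/
def IndependenceCondition {R K : Type} [Ring R] [DivisionRing K] (ε : R →+* ℚ) (ι : R →+* K) :
    Prop :=
  ∀ (I α : Type) (C : I → α →₀ R), LinearIndependent ℚ (fun i => coeffMap ε (C i)) →
    Function.Injective (rightComb (S := K) fun i => coeffMap ι (C i))

variable {R K : Type} [Ring R] [DivisionRing K] {ε : R →+* ℚ} {ι : R →+* K}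

lemma coeffMap_coeffMap_rat {R β : Type} [Ring R] (ε : R →+* ℚ) (η : ℚ →+* R) (q : β →₀ ℚ) :
    coeffMap ε (coeffMap η q) = q := by
  rw [coeffMap_coeffMap, Subsingleton.elim (ε.comp η) (RingHom.id ℚ)]; ext; simp

/-- If all solutions over `ℚ` of an augmented finite system of linear equations lift to solutions
over `R` in a set `L`, then `L` spans the solutions over `K`: the rank of the system over `K` is at
least its rank over `ℚ`, and the elements of `L` span a subspace of at least the complementary
dimension. -/
theorem IndependenceCondition.mem_span_of_rightComb_eq_zero (h : IndependenceCondition ε ι)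
    (η : ℚ →+* R) {I α : Type} [Finite I] (J : I → α →₀ R) (L : Set (I →₀ R))
    (hL : ∀ Z ∈ L, rightComb J Z = 0)
    (hlift : ∀ q : I →₀ ℚ, rightComb (fun i => coeffMap ε (J i)) q = 0 →
      ∃ Z ∈ L, coeffMap ε Z = q)
    (z : I →₀ K) (hz : rightComb (fun i => coeffMap ι (J i)) z = 0) :
    z ∈ Submodule.span Kᵐᵒᵖ (coeffMap ι '' L) := by
  classical
  have : Fintype I := Fintype.ofFinite I
  let T : (I →₀ ℚ) →ₗ[ℚ] (α →₀ ℚ) := Finsupp.linearCombination ℚ fun i => coeffMap ε (J i)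
  have hT : ∀ q, rightComb (fun i => coeffMap ε (J i)) q = T q := rightComb_rat_eq _
  obtain ⟨W, hW⟩ := T.ker.exists_isCompl
  let b := Module.finBasis ℚ T.ker
  let c := Module.finBasis ℚ W
  let B := (b.prod c).map (Submodule.prodEquivOfIsCompl _ _ hW)
  choose X hXL hX using fun k => hlift (b k) (by rw [hT]; exact (b k).2)
  -- a square system of vectors over `R`, lifting a basis over `ℚ` adapted to the kernel
  let C : Fin _ ⊕ Fin _ → I →₀ R := Sum.elim X fun k => coeffMap η (c k : I →₀ ℚ)
  have hC : (fun i => coeffMap ε (C i)) = B := by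
    ext1 i
    rcases i with k | k
    · simp [C, B, hX]
    · simp [C, B, coeffMap_coeffMap_rat ε η]
  have hinj := h _ _ C (hC ▸ B.linearIndependent)
  let e := Finsupp.domLCongr (M := K) (R := Kᵐᵒᵖ) (B.indexEquiv (Finsupp.basisSingleOne (ι := I)))
  obtain ⟨t, ht⟩ := rightLinear_surjective_of_injective
    (f := rightComb (fun i => coeffMap ι (C i)) ∘ₗ e.symm.toLinearMap)
    (hinj.comp e.symm.injective) z
  set u := e.symm t
  replace ht : rightComb (fun i => coeffMap ι (C i)) u = z := ht
  rw [rightComb_eq_sum, Fintype.sum_sum_type] at ht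
  -- the vectors lifting the complement of the kernel have independent images
  have hinjD := h _ _ (fun k => rightComb J (coeffMap η (c k : I →₀ ℚ))) (by
    have : (fun k => coeffMap ε (rightComb J (coeffMap η (c k : I →₀ ℚ)))) =
        fun k => T (c k) := by
      ext1 k; rw [coeffMap_rightComb, coeffMap_coeffMap_rat ε η, hT]
    rw [this]
    refine (c.linearIndependent.map' W.subtype W.ker_subtype).map (f := T) ?_
    refine hW.symm.disjoint.mono_left ?_
    rw [Submodule.span_le]
    rintro _ ⟨k, rfl⟩
    exact (c k).2)
  let v : Fin _ →₀ K := Finsupp.equivFunOnFinite.symm fun k => u (Sum.inr k)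
  have hv : rightComb (fun k => coeffMap ι (rightComb J (coeffMap η (c k : I →₀ ℚ)))) v = 0 := by
    rw [← ht, map_add, map_sum, map_sum, Finset.sum_eq_zero (s := Finset.univ) fun k _ => ?_] at hz
    · rw [zero_add] at hz
      rw [rightComb_eq_sum, ← hz]
      refine Finset.sum_congr rfl fun k _ => ?_
      rw [map_smul, ← coeffMap_rightComb]
      rfl
    · rw [map_smul, ← coeffMap_rightComb]
      simp [C, hL _ (hXL k)]
  have hv0 : v = 0 := hinjD (by rw [hv, map_zero])
  rw [← ht]
  refine Submodule.add_mem _ (Submodule.sum_mem _ fun k _ => Submodule.smul_mem _ _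
    (Submodule.subset_span ⟨_, hXL k, rfl⟩)) ?_
  rw [Finset.sum_eq_zero]
  · exact Submodule.zero_mem _
  · intro k _
    have : u (Sum.inr k) = 0 := DFunLike.congr_fun hv0 k
    rw [this, MulOpposite.op_zero, zero_smul]

/-- If an augmented finite system of linear equations is solvable over `ℚ` for every right-hand
side, then it is so over `K`. -/
theorem IndependenceCondition.rightComb_surjective (h : IndependenceCondition ε ι)
    (η : ℚ →+* R) {I α : Type} [Finite I] (J : I → α →₀ R)
    (hJ : Function.Surjective (rightComb (S := ℚ) fun i => coeffMap ε (J i))) :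
    Function.Surjective (rightComb (S := K) fun i => coeffMap ι (J i)) := by
  have : Finite α := by
    have h1 : Function.Surjective (Finsupp.linearCombination ℚ fun i => coeffMap ε (J i)) := by
      intro y
      obtain ⟨x, rfl⟩ := hJ y
      exact ⟨x, (rightComb_rat_eq _ x).symm⟩
    have := Module.Finite.of_surjective _ h1
    exact Module.Finite.finite_basis (Finsupp.basisSingleOne (R := ℚ) (ι := α))
  choose C hC using fun a => hJ (.single a 1)
  have hinj := h _ _ (fun a => rightComb J (coeffMap η (C a))) (by
    have : (fun a => coeffMap ε (rightComb J (coeffMap η (C a)))) =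
        fun a => .single a (1 : ℚ) := by
      ext1 a; rw [coeffMap_rightComb, coeffMap_coeffMap_rat ε η, hC]
    rw [this]
    exact (Finsupp.basisSingleOne (R := ℚ) (ι := α)).linearIndependent)
  intro y
  obtain ⟨x, rfl⟩ := rightLinear_surjective_of_injective hinj y
  refine ⟨rightComb (fun a => coeffMap ι (coeffMap η (C a))) x, ?_⟩
  rw [map_rightComb]
  simp only [coeffMap_rightComb]

end LinearAlgebra

section Comparison

variable {A B F I J R : Type} [Group A] [Group B] [Group F] [Ring R]

lemma mapDomain_mem_range_barD₂_of_eq_one {S G I J : Type} [Ring S] [Group G] (ρ : G →* S)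
    (a : I → G) (j : J → I) (haj : ∀ k, a (j k) = 1) (y : J →₀ S) :
    (y.mapDomain j).mapDomain a ∈ LinearMap.range (barD₂ ρ) := by
  rw [← Finsupp.mapDomain_comp]
  have : a ∘ j = fun _ => 1 := funext haj
  rw [this]
  induction y using Finsupp.induction_linear with
  | zero => simp
  | add x y hx hy => rw [Finsupp.mapDomain_add]; exact Submodule.add_mem _ hx hy
  | single k s => rw [Finsupp.mapDomain_single]; exact single_one_mem_range_barD₂ s

/-- Let `u : I → F` lift `φ ∘ a`, where `a` generates `A`. A rational 1-chain on the words
`u` that bounds over `F` lifts to a 1-chain over `R` that bounds over `F` and whose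
counterpart on `a` bounds over `A`. This uses that `H₁(A; ℚ) → H₁(B; ℚ)` is injective and that
`H₂(B; ℚ)` is generated by classes from `A` and from a subgroup `B₀` acting trivially on `R`. -/
theorem exists_lift_of_mem_range_barD₂ (φ : A →* B) (π : F →* B) (ρ : B →* R)
    (hπ : Function.Surjective π) (B₀ : Subgroup B) (hB₀ : ∀ b ∈ B₀, ρ b = 1)
    (ε : R →+* ℚ) (η : ℚ →+* R) (hερ : ∀ b, ε (ρ b) = 1)
    (h₁ : ∀ c : A →₀ ℚ, c.mapDomain φ ∈ LinearMap.range (barD₂ (1 : B →* ℚ)) →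
      c ∈ LinearMap.range (barD₂ (1 : A →* ℚ)))
    (h₂ : ∀ z : B × B →₀ ℚ, barD₂ 1 z = 0 → ∃ (w : A × A →₀ ℚ) (β : B₀ × B₀ →₀ ℚ)
      (e : B × B × B →₀ ℚ), barD₂ 1 w = 0 ∧ barD₂ 1 β = 0 ∧
        z = w.mapDomain (Prod.map φ φ) + β.mapDomain (Prod.map B₀.subtype B₀.subtype) + barD₃ 1 e)
    (a : I → A) (ha : Subgroup.closure (Set.range a) = ⊤) (u : I → F)
    (hu : ∀ i, π (u i) = φ (a i)) (j : J → I) (haj : ∀ k, a (j k) = 1)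
    (hr : π.ker = Subgroup.normalClosure (Set.range fun k => u (j k)))
    (z : I →₀ ℚ) (hz : z.mapDomain u ∈ LinearMap.range (barD₂ (1 : F →* ℚ))) :
    ∃ Z : I →₀ R, coeffMap ε Z = z ∧ Z.mapDomain a ∈ LinearMap.range (barD₂ (ρ.comp φ)) ∧
      Z.mapDomain u ∈ LinearMap.range (barD₂ (ρ.comp π)) := by
  have hε : (ε : R →* ℚ).comp ρ = 1 := MonoidHom.ext hερ
  have hεG : ∀ {G : Type} [Group G] (f : G →* B), (ε : R →* ℚ).comp (ρ.comp f) = 1 := fun f =>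
    MonoidHom.ext fun g => hερ (f g)
  have hπu : π ∘ u = φ ∘ a := funext hu
  obtain ⟨v, hv⟩ := hz
  -- the rational 2-chain `w` of `A` bounding `z`, corrected by a cycle of `A`
  obtain ⟨w₀, hw₀⟩ := h₁ (z.mapDomain a) ⟨v.mapDomain (Prod.map π π), by
    rw [barD₂_mapDomain, MonoidHom.one_comp, hv, ← Finsupp.mapDomain_comp, hπu,
      Finsupp.mapDomain_comp]⟩
  obtain ⟨w', β, e, hw', hβ, hsum⟩ := h₂
    (v.mapDomain (Prod.map π π) - w₀.mapDomain (Prod.map φ φ)) (by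
      rw [map_sub, barD₂_mapDomain, barD₂_mapDomain, MonoidHom.one_comp, MonoidHom.one_comp, hv,
        hw₀, ← Finsupp.mapDomain_comp, ← Finsupp.mapDomain_comp, hπu, sub_self])
  obtain ⟨w, hw, hwsum⟩ : ∃ w : A × A →₀ ℚ, barD₂ 1 w = z.mapDomain a ∧
      v.mapDomain (Prod.map π π) - w.mapDomain (Prod.map φ φ) =
        β.mapDomain (Prod.map B₀.subtype B₀.subtype) + barD₃ 1 e := by
    refine ⟨w₀ + w', by rw [map_add, hw₀, hw', add_zero], ?_⟩
    rw [Finsupp.mapDomain_add, ← sub_sub, hsum]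
    abel
  -- the cycle of `B₀` remains a cycle over `R`
  have hβR : barD₂ ρ ((coeffMap η β).mapDomain (Prod.map B₀.subtype B₀.subtype)) = 0 := by
    have h1 : ρ.comp B₀.subtype = (η : ℚ →* R).comp 1 :=
      MonoidHom.ext fun b => (hB₀ b b.2).trans (map_one η).symm
    rw [barD₂_mapDomain, h1, ← coeffMap_barD₂, hβ, map_zero, Finsupp.mapDomain_zero]
  -- `κ` is the defect of the lifted relation; it has coefficients in the augmentation ideal
  set κ : B × B →₀ R := (coeffMap η v).mapDomain (Prod.map π π) -
    (coeffMap η w).mapDomain (Prod.map φ φ) -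
    (coeffMap η β).mapDomain (Prod.map B₀.subtype B₀.subtype) - barD₃ ρ (coeffMap η e) with hκ
  have hεκ : coeffMap ε κ = 0 := by
    rw [hκ]
    simp only [map_sub, coeffMap_mapDomain, coeffMap_barD₃, coeffMap_coeffMap_rat ε η, hε]
    rw [hwsum]
    abel
  have hdκ : barD₂ ρ κ = (barD₂ (ρ.comp π) (coeffMap η v)).mapDomain π -
      (barD₂ (ρ.comp φ) (coeffMap η w)).mapDomain φ := by
    rw [hκ, map_sub, map_sub, map_sub, hβR, barD₂_barD₃, barD₂_mapDomain, barD₂_mapDomain,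
      sub_zero, sub_zero]
  obtain ⟨P, V, hPV⟩ := exists_barChain_generators a ha (ρ.comp φ)
  obtain ⟨Y, V₁, Y', V₂, hYV⟩ := exists_barChain_relators π hπ (fun k => u (j k)) hr ρ
  -- correct `z` so that it bounds in `A`
  set x : A →₀ R := barD₂ (ρ.comp φ) (coeffMap η w) - (coeffMap η z).mapDomain a with hx
  clear_value x
  have hεx : coeffMap ε x = 0 := by
    rw [hx, map_sub, coeffMap_barD₂, hεG, coeffMap_coeffMap_rat ε η, hw, coeffMap_mapDomain,
      coeffMap_coeffMap_rat ε η, sub_self]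
  set Z₁ := coeffMap η z + P x with hZ₁
  have hZ₁a : Z₁.mapDomain a = barD₂ (ρ.comp φ) (coeffMap η w - V x) := by
    have := hPV x
    rw [← sub_eq_iff_eq_add] at this
    have hx' : (coeffMap η z).mapDomain a = barD₂ (ρ.comp φ) (coeffMap η w) - x := by
      rw [hx, sub_sub_cancel]
    rw [hZ₁, Finsupp.mapDomain_add, ← this, hx', map_sub (barD₂ (ρ.comp φ))]
    abel
  have hεZ₁ : coeffMap ε Z₁ = z := by
    rw [hZ₁, map_add, coeffMap_coeffMap_rat ε η, coeffMap_apply_eq_zero ε P hεx, add_zero]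
  -- correct it further so that it bounds in `F`
  set c : F →₀ R := Z₁.mapDomain u - barD₂ (ρ.comp π) (coeffMap η v) with hc
  have hεc : coeffMap ε c = 0 := by
    rw [hc, map_sub, coeffMap_mapDomain, hεZ₁, coeffMap_barD₂, hεG,
      coeffMap_coeffMap_rat ε η, hv, sub_self]
  set e' : B × B →₀ R := -κ - (V x).mapDomain (Prod.map φ φ) with he'
  have hεe' : coeffMap ε e' = 0 := by
    rw [he', map_sub, map_neg, hεκ, coeffMap_mapDomain, coeffMap_apply_eq_zero ε V hεx,
      Finsupp.mapDomain_zero, neg_zero, sub_zero]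
  have hce : c.mapDomain π = barD₂ ρ e' := by
    rw [hc, lmapDomain_sub, ← Finsupp.mapDomain_comp, hπu, Finsupp.mapDomain_comp, hZ₁a, he',
      map_sub (barD₂ ρ), map_neg (barD₂ ρ), hdκ,
      map_sub (barD₂ (ρ.comp φ)), lmapDomain_sub, barD₂_mapDomain]
    abel
  have hfin := hYV c e' hce
  refine ⟨Z₁ - (Y c + Y' e').mapDomain j, ?_, ?_, ?_⟩
  · rw [map_sub, hεZ₁, coeffMap_mapDomain, map_add, coeffMap_apply_eq_zero ε Y hεc,
      coeffMap_apply_eq_zero ε Y' hεe', add_zero, Finsupp.mapDomain_zero, sub_zero]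
  · rw [lmapDomain_sub]
    exact Submodule.sub_mem _ ⟨_, hZ₁a.symm⟩
      (mapDomain_mem_range_barD₂_of_eq_one (ρ.comp φ) a j haj _)
  · refine ⟨coeffMap η v + (V₁ c + V₂ e'), ?_⟩
    have hju : (u ∘ j) = fun k => u (j k) := rfl
    rw [lmapDomain_sub, ← Finsupp.mapDomain_comp, hju, map_add, eq_sub_iff_add_eq, add_assoc,
      add_comm (barD₂ _ (V₁ c + V₂ e')), ← hfin, hc]
    abel

end Comparison

/-! ### Comparison of chains over a skew field -/

section SkewField

variable {A B α I J R K : Type} [Group A] [Group B] [Ring R] [DivisionRing K]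

lemma mapDomain_hom_mem_range_barD₂ {S G H : Type} [Ring S] [Group G] [Group H] (ρ : G →* S)
    (f : H →* G) {c : H →₀ S} (hc : c ∈ LinearMap.range (barD₂ (ρ.comp f))) :
    c.mapDomain f ∈ LinearMap.range (barD₂ ρ) := by
  obtain ⟨x, rfl⟩ := hc
  exact ⟨_, barD₂_mapDomain ρ f x⟩

lemma barD₁_eq_zero_of_sub_mem {S : Type} [Ring S] {φ : A →* B} {ρ : B →* S} {b : B →₀ S}
    {c : A →₀ S}
    (hb : barD₁ ρ b = 0) (h : b - c.mapDomain φ ∈ LinearMap.range (barD₂ ρ)) :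
    barD₁ (ρ.comp φ) c = 0 := by
  obtain ⟨e, he⟩ := h
  have := barD₁_barD₂ ρ e
  rwa [he, map_sub, hb, zero_sub, neg_eq_zero, barD₁_mapDomain] at this

lemma foxChain_mapDomain {S : Type} [Ring S] (ρ : FreeGroup α →* S) (u : I → FreeGroup α)
    (z : I →₀ S) : foxChain ρ (z.mapDomain u) = rightComb (fun i => foxDerivative ρ (u i)) z := by
  suffices foxChain ρ ∘ₗ Finsupp.lmapDomain S Sᵐᵒᵖ u = rightComb fun i => foxDerivative ρ (u i) from
    LinearMap.congr_fun this z
  exact rightLinear_ext fun i => by simp [foxChain]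

/-- A 1-chain of `F` whose image in `B` bounds can be corrected by relators so that it bounds
in `F`. -/
lemma exists_sub_mapDomain_mem {S F : Type} [Ring S] [Group F] (π : F →* B)
    (ρ : B →* S) (hπ : Function.Surjective π) (u : I → F) (j : J → I)
    (hr : π.ker = Subgroup.normalClosure (Set.range fun k => u (j k))) (c : F →₀ S)
    (hc : c.mapDomain π ∈ LinearMap.range (barD₂ ρ)) :
    ∃ y : J →₀ S, c - (y.mapDomain j).mapDomain u ∈ LinearMap.range (barD₂ (ρ.comp π)) := by
  obtain ⟨Y, V₁, Y', V₂, hYV⟩ := exists_barChain_relators π hπ (fun k => u (j k)) hr ρ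
  obtain ⟨e, he⟩ := hc
  have := hYV c e he.symm
  refine ⟨Y c + Y' e, V₁ c + V₂ e, ?_⟩
  rw [← Finsupp.mapDomain_comp, eq_sub_iff_add_eq, add_comm]
  exact this.symm

variable [Finite I] {ε : R →+* ℚ} {ι : R →+* K} (φ : A →* B) (π : FreeGroup α →* B) (ρ : B →* R)
  (a : I → A) (u : I → FreeGroup α) (j : J → I)

/-- Injectivity of `H₁(A; K) → H₁(B; K)`, on the level of chains. -/
theorem IndependenceCondition.mem_range_barD₂ (hι : IndependenceCondition ε ι) (η : ℚ →+* R)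
    (hερ : ∀ b, ε (ρ b) = 1) (hπ : Function.Surjective π)
    (B₀ : Subgroup B) (hB₀ : ∀ b ∈ B₀, ρ b = 1)
    (h₁ : ∀ c : A →₀ ℚ, c.mapDomain φ ∈ LinearMap.range (barD₂ (1 : B →* ℚ)) →
      c ∈ LinearMap.range (barD₂ (1 : A →* ℚ)))
    (h₂ : ∀ z : B × B →₀ ℚ, barD₂ 1 z = 0 → ∃ (w : A × A →₀ ℚ) (β : B₀ × B₀ →₀ ℚ)
      (e : B × B × B →₀ ℚ), barD₂ 1 w = 0 ∧ barD₂ 1 β = 0 ∧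
        z = w.mapDomain (Prod.map φ φ) + β.mapDomain (Prod.map B₀.subtype B₀.subtype) + barD₃ 1 e)
    (ha : Subgroup.closure (Set.range a) = ⊤)
    (hu : ∀ i, π (u i) = φ (a i)) (haj : ∀ k, a (j k) = 1)
    (hr : π.ker = Subgroup.normalClosure (Set.range fun k => u (j k)))
    (c : A →₀ K)
    (hc : c.mapDomain φ ∈ LinearMap.range (barD₂ ((ι : R →* K).comp ρ))) :
    c ∈ LinearMap.range (barD₂ (((ι : R →* K).comp ρ).comp φ)) := by
  have hπu : π ∘ u = φ ∘ a := funext hu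
  obtain ⟨P, V, hPV⟩ := exists_barChain_generators a ha (((ι : R →* K).comp ρ).comp φ)
  have hcP : c - (P c).mapDomain a ∈ LinearMap.range (barD₂ (((ι : R →* K).comp ρ).comp φ)) :=
    ⟨V c, by rw [eq_sub_iff_add_eq, add_comm]; exact (hPV c).symm⟩
  obtain ⟨y, hy⟩ := exists_sub_mapDomain_mem π ((ι : R →* K).comp ρ) hπ u j hr
    ((P c).mapDomain u) (by
      rw [← Finsupp.mapDomain_comp, hπu, Finsupp.mapDomain_comp]
      have := Submodule.sub_mem _ hc (mapDomain_hom_mem_range_barD₂ _ φ hcP)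
      rwa [lmapDomain_sub, sub_sub_cancel] at this)
  rw [← lmapDomain_sub] at hy
  set z := P c - y.mapDomain j with hz
  let L : Set (I →₀ R) := {Z | Z.mapDomain a ∈ LinearMap.range (barD₂ (ρ.comp φ)) ∧
    Z.mapDomain u ∈ LinearMap.range (barD₂ (ρ.comp π))}
  have hspan := hι.mem_span_of_rightComb_eq_zero η (fun i => foxDerivative (ρ.comp π) (u i)) L
    (fun Z hZ => by rw [← foxChain_mapDomain, foxChain_eq_zero_iff]; exact hZ.2)
    (fun q hq => by
      simp only [coeffMap_foxDerivative] at hq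
      rw [← foxChain_mapDomain, foxChain_eq_zero_iff] at hq
      have : (ε : R →* ℚ).comp (ρ.comp π) = 1 := MonoidHom.ext fun g => hερ (π g)
      rw [this] at hq
      obtain ⟨Z, hZ, hZa, hZu⟩ := exists_lift_of_mem_range_barD₂ φ π ρ hπ B₀ hB₀ ε η hερ h₁ h₂ a ha
        u hu j haj hr q hq
      exact ⟨Z, ⟨hZa, hZu⟩, hZ⟩) z (by
      simp only [coeffMap_foxDerivative]
      rw [← foxChain_mapDomain, foxChain_eq_zero_iff]
      exact hy)
  have hza : z.mapDomain a ∈ LinearMap.range (barD₂ (((ι : R →* K).comp ρ).comp φ)) := by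
    have : Submodule.span Kᵐᵒᵖ (coeffMap ι '' L) ≤
        (LinearMap.range (barD₂ (((ι : R →* K).comp ρ).comp φ))).comap
          (Finsupp.lmapDomain K Kᵐᵒᵖ a) := by
      rw [Submodule.span_le]
      rintro _ ⟨Z, ⟨⟨x, hx⟩, -⟩, rfl⟩
      refine ⟨coeffMap ι x, ?_⟩
      rw [Finsupp.lmapDomain_apply, ← coeffMap_mapDomain, ← hx, coeffMap_barD₂]
      rfl
    exact this hspan
  rw [hz, lmapDomain_sub] at hza
  have := Submodule.add_mem _ (Submodule.add_mem _ hcP hza)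
    (mapDomain_mem_range_barD₂_of_eq_one (((ι : R →* K).comp ρ).comp φ) a j haj y)
  convert this using 1
  abel

/-- Surjectivity of `H₁(A; K) → H₁(B; K)`, on the level of chains. -/
theorem IndependenceCondition.exists_sub_mem_range_barD₂ (hι : IndependenceCondition ε ι)
    (η : ℚ →+* R) (hερ : ∀ b, ε (ρ b) = 1) (hπ : Function.Surjective π)
    (h₃ : ∀ b : B →₀ ℚ, ∃ c : A →₀ ℚ,
      b - c.mapDomain φ ∈ LinearMap.range (barD₂ (1 : B →* ℚ)))
    (ha : Subgroup.closure (Set.range a) = ⊤)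
    (hu : ∀ i, π (u i) = φ (a i))
    (hr : π.ker = Subgroup.normalClosure (Set.range fun k => u (j k)))
    (b : B →₀ K) :
    ∃ c : A →₀ K, b - c.mapDomain φ ∈ LinearMap.range (barD₂ ((ι : R →* K).comp ρ)) := by
  have hπu : π ∘ u = φ ∘ a := funext hu
  have hε : (ε : R →* ℚ).comp (ρ.comp π) = (1 : B →* ℚ).comp π :=
    MonoidHom.ext fun g => hερ (π g)
  have hsurj := hι.rightComb_surjective η (fun i => foxDerivative (ρ.comp π) (u i)) <| by
    intro q
    simp only [coeffMap_foxDerivative, ← foxChain_mapDomain, hε]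
    obtain ⟨c, hc⟩ := h₃ ((q.mapDomain FreeGroup.of).mapDomain π)
    obtain ⟨P, V, hPV⟩ := exists_barChain_generators a ha (1 : A →* ℚ)
    have hcP : c - (P c).mapDomain a ∈ LinearMap.range (barD₂ (1 : A →* ℚ)) :=
      ⟨V c, by rw [eq_sub_iff_add_eq, add_comm]; exact (hPV c).symm⟩
    obtain ⟨y, hy⟩ := exists_sub_mapDomain_mem π (1 : B →* ℚ) hπ u j hr
      (q.mapDomain FreeGroup.of - (P c).mapDomain u) (by
        rw [lmapDomain_sub, ← Finsupp.mapDomain_comp (g := π) (f := u), hπu,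
          Finsupp.mapDomain_comp (g := φ)]
        have := Submodule.add_mem _ hc (mapDomain_hom_mem_range_barD₂ (1 : B →* ℚ) φ hcP)
        rwa [lmapDomain_sub, sub_add_sub_cancel] at this)
    refine ⟨P c + y.mapDomain j, ?_⟩
    rw [← foxChain_eq_zero_iff, map_sub, map_sub, foxChain_mapDomain_of, sub_sub, sub_eq_zero] at hy
    rw [Finsupp.mapDomain_add, map_add, ← hy]
  obtain ⟨b', rfl⟩ := Finsupp.mapDomain_surjective hπ b
  obtain ⟨z, hz⟩ := hsurj (foxChain (((ι : R →* K).comp ρ).comp π) b')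
  refine ⟨z.mapDomain a, ?_⟩
  rw [← Finsupp.mapDomain_comp (g := φ), ← hπu, Finsupp.mapDomain_comp (g := π), ← lmapDomain_sub]
  refine mapDomain_hom_mem_range_barD₂ _ π ?_
  simp only [coeffMap_foxDerivative] at hz
  rw [← foxChain_eq_zero_iff, map_sub, ← hz, foxChain_mapDomain, sub_eq_zero]
  rfl

end SkewField

/-! ### Group homology in terms of chains -/

section RationalHomology

variable {A B : Type} [Group A] [Group B]

lemma d₂₁_trivial_apply {G : Type} [Group G] (x : G × G →₀ ℚ) :
    groupHomology.d₂₁ (Rep.trivial ℚ G ℚ) x = barD₂ (1 : G →* ℚ) x := by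
  induction x using Finsupp.induction_linear with
  | zero => simp
  | add x y hx hy => rw [map_add, hx, hy, ← map_add]
  | single g s =>
    obtain ⟨g, h⟩ := g
    rw [groupHomology.d₂₁_single, barD₂_single]
    simp

lemma d₃₂_trivial_apply {G : Type} [Group G] (x : G × G × G →₀ ℚ) :
    groupHomology.d₃₂ (Rep.trivial ℚ G ℚ) x = barD₃ (1 : G →* ℚ) x := by
  induction x using Finsupp.induction_linear with
  | zero => simp
  | add x y hx hy => rw [map_add, hx, hy, ← map_add]
  | single g s =>
    obtain ⟨g, h, k⟩ := g
    rw [groupHomology.d₃₂_single, barD₃_single]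
    simp

/-- The class in `H₁(G; ℚ)` of a 1-chain; with trivial coefficients every 1-chain is a cycle. -/
noncomputable def rationalClass₁ (G : Type) [Group G] :
    (G →₀ ℚ) →ₗ[ℚ] groupHomology (Rep.trivial ℚ G ℚ) 1 :=
  (groupHomology.H1π (Rep.trivial ℚ G ℚ)).hom ∘ₗ
    (LinearMap.id.codRestrict (groupHomology.cycles₁ (Rep.trivial ℚ G ℚ)) fun x => by
      rw [groupHomology.cycles₁_eq_top_of_isTrivial]; trivial)

lemma rationalClass₁_eq_zero_iff {G : Type} [Group G] (x : G →₀ ℚ) :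
    rationalClass₁ G x = 0 ↔ x ∈ LinearMap.range (barD₂ (1 : G →* ℚ)) := by
  refine (groupHomology.H1π_eq_zero_iff _).trans ?_
  constructor
  · rintro ⟨y, hy⟩
    exact ⟨y, (d₂₁_trivial_apply y).symm.trans hy⟩
  · rintro ⟨y, hy⟩
    exact ⟨y, (d₂₁_trivial_apply y).trans hy⟩

lemma rationalClass₁_surjective (G : Type) [Group G] : Function.Surjective (rationalClass₁ G) := by
  intro x
  induction x using groupHomology.H1_induction_on with | _ x
  exact ⟨x.1, rfl⟩

lemma rationalHomologyMap_rationalClass₁ (φ : A →* B) (x : A →₀ ℚ) :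
    rationalHomologyMap φ 1 (rationalClass₁ A x) = rationalClass₁ B (x.mapDomain φ) := by
  refine (groupHomology.H1π_comp_map_apply (A := Rep.trivial ℚ A ℚ) (B := Rep.trivial ℚ B ℚ) φ
    (𝟙 (Rep.trivial ℚ A ℚ)) _).trans ?_
  refine congrArg (groupHomology.H1π (Rep.trivial ℚ B ℚ)) (Subtype.ext ?_)
  exact Finsupp.mapRange_id _

/-- Injectivity of `H₁(A; ℚ) → H₁(B; ℚ)`, on the level of chains. -/
lemma mem_range_barD₂_of_injective {φ : A →* B} (hφ : Function.Injective (rationalHomologyMap φ 1))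
    (c : A →₀ ℚ) (hc : c.mapDomain φ ∈ LinearMap.range (barD₂ (1 : B →* ℚ))) :
    c ∈ LinearMap.range (barD₂ (1 : A →* ℚ)) := by
  rw [← rationalClass₁_eq_zero_iff] at hc ⊢
  apply hφ
  rw [rationalHomologyMap_rationalClass₁, hc, map_zero]

/-- Surjectivity of `H₁(A; ℚ) → H₁(B; ℚ)`, on the level of chains. -/
lemma exists_sub_mem_range_barD₂_of_surjective {φ : A →* B}
    (hφ : Function.Surjective (rationalHomologyMap φ 1)) (b : B →₀ ℚ) :
    ∃ c : A →₀ ℚ, b - c.mapDomain φ ∈ LinearMap.range (barD₂ (1 : B →* ℚ)) := by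
  obtain ⟨x, hx⟩ := hφ (rationalClass₁ B b)
  obtain ⟨c, rfl⟩ := rationalClass₁_surjective A x
  refine ⟨c, ?_⟩
  rw [← rationalClass₁_eq_zero_iff, map_sub, ← hx, rationalHomologyMap_rationalClass₁, sub_self]

lemma rationalHomologyMap_H2π (φ : A →* B)
    (x : groupHomology.cycles₂ (Rep.trivial ℚ A ℚ)) :
    ∃ y : groupHomology.cycles₂ (Rep.trivial ℚ B ℚ),
      y.1 = Finsupp.mapDomain (M := ℚ) (Prod.map φ φ) x.1 ∧
      rationalHomologyMap φ 2 (groupHomology.H2π _ x) = groupHomology.H2π _ y :=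
  ⟨_, Finsupp.mapRange_id _, groupHomology.H2π_comp_map_apply (A := Rep.trivial ℚ A ℚ)
    (B := Rep.trivial ℚ B ℚ) φ (𝟙 (Rep.trivial ℚ A ℚ)) x⟩

/-- The condition that `H₂(B; ℚ)` is spanned by two images, on the level of chains. -/
lemma exists_cycles_of_range_sup_range_eq_top {C : Type} [Group C] (φ : A →* B) (ψ : C →* B)
    (h : LinearMap.range (rationalHomologyMap φ 2) ⊔
      LinearMap.range (rationalHomologyMap ψ 2) = ⊤)
    (z : B × B →₀ ℚ) (hz : barD₂ 1 z = 0) :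
    ∃ (w : A × A →₀ ℚ) (β : C × C →₀ ℚ) (e : B × B × B →₀ ℚ), barD₂ 1 w = 0 ∧ barD₂ 1 β = 0 ∧
      z = w.mapDomain (Prod.map φ φ) + β.mapDomain (Prod.map ψ ψ) + barD₃ 1 e := by
  let z' : groupHomology.cycles₂ (Rep.trivial ℚ B ℚ) := ⟨z, (d₂₁_trivial_apply z).trans hz⟩
  obtain ⟨_, ⟨x, rfl⟩, _, ⟨y, rfl⟩, hxy⟩ := Submodule.mem_sup.1
    (h ▸ Submodule.mem_top (x := groupHomology.H2π (Rep.trivial ℚ B ℚ) z'))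
  induction x using groupHomology.H2_induction_on with | _ w
  induction y using groupHomology.H2_induction_on with | _ β
  obtain ⟨w', hw', hw⟩ := rationalHomologyMap_H2π φ w
  obtain ⟨β', hβ', hβ⟩ := rationalHomologyMap_H2π ψ β
  rw [hw, hβ, ← map_add] at hxy
  obtain ⟨e, he⟩ := (groupHomology.H2π_eq_iff _ _).1 hxy.symm
  refine ⟨w.1, β.1, e, (d₂₁_trivial_apply _).symm.trans w.2, (d₂₁_trivial_apply _).symm.trans β.2,
    ?_⟩
  have he' : barD₃ 1 e = z - (w'.1 + β'.1) := (d₃₂_trivial_apply e).symm.trans he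
  rw [he', hw', hβ', add_sub_cancel]

end RationalHomology

section TwistedHomology

open MulOpposite

variable {A B K : Type} [Group A] [Group B] [Ring K] [Algebra ℚ K]

lemma d₁₀_coeffRep_apply {G : Type} [Group G] (ρ : G →* K) (x : G →₀ K) :
    groupHomology.d₁₀ (coeffRep ρ) x = barD₁ ρ x := by
  induction x using Finsupp.induction_linear with
  | zero => simp
  | add x y hx hy => rw [map_add, hx, hy, ← map_add]
  | single g s =>
    rw [groupHomology.d₁₀_single, barD₁_single]
    rfl

lemma d₂₁_coeffRep_apply {G : Type} [Group G] (ρ : G →* K) (x : G × G →₀ K) :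
    groupHomology.d₂₁ (coeffRep ρ) x = barD₂ ρ x := by
  induction x using Finsupp.induction_linear with
  | zero => simp
  | add x y hx hy => rw [map_add, hx, hy, ← map_add]
  | single g s =>
    obtain ⟨g, h⟩ := g
    rw [groupHomology.d₂₁_single, barD₂_single]
    rfl

/-- The class in `H₁(G; K)` of a 1-cycle. -/
noncomputable def twistedClass {G : Type} [Group G] (ρ : G →* K) :
    LinearMap.ker (barD₁ ρ) →ₗ[Kᵐᵒᵖ] TwistedHomology ρ 1 where
  toFun x := groupHomology.H1π (coeffRep ρ) ⟨x.1, (d₁₀_coeffRep_apply ρ x.1).trans x.2⟩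
  map_add' x y := map_add (groupHomology.H1π (coeffRep ρ)).hom
    ⟨x.1, (d₁₀_coeffRep_apply ρ x.1).trans x.2⟩ ⟨y.1, (d₁₀_coeffRep_apply ρ y.1).trans y.2⟩
  map_smul' c x := by
    refine Eq.symm ((groupHomology.H1π_comp_map_apply (A := coeffRep ρ) (B := coeffRep ρ)
      (MonoidHom.id G) (coeffRightMul ρ c.unop) _).trans ?_)
    refine congrArg (groupHomology.H1π (coeffRep ρ)) (Subtype.ext ?_)
    refine (congrArg (Finsupp.mapRange (· * c.unop) (zero_mul _))
      (Finsupp.mapDomain_id (v := x.1))).trans ?_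
    ext g
    rfl

lemma twistedClass_eq_zero_iff {G : Type} [Group G] (ρ : G →* K) (x : LinearMap.ker (barD₁ ρ)) :
    twistedClass ρ x = 0 ↔ x.1 ∈ LinearMap.range (barD₂ ρ) := by
  refine (groupHomology.H1π_eq_zero_iff _).trans ?_
  constructor
  · rintro ⟨y, hy⟩
    exact ⟨y, (d₂₁_coeffRep_apply ρ y).symm.trans hy⟩
  · rintro ⟨y, hy⟩
    exact ⟨y, (d₂₁_coeffRep_apply ρ y).trans hy⟩

lemma twistedClass_surjective {G : Type} [Group G] (ρ : G →* K) :
    Function.Surjective (twistedClass ρ) := by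
  intro (x : groupHomology.H1 (coeffRep ρ))
  induction x using groupHomology.H1_induction_on with | _ x
  exact ⟨⟨x.1, (d₁₀_coeffRep_apply ρ x.1).symm.trans x.2⟩, rfl⟩

lemma TwistedHomology.map_twistedClass (φ : A →* B) (ρ : B →* K)
    (x : LinearMap.ker (barD₁ (ρ.comp φ))) :
    TwistedHomology.map φ ρ 1 (twistedClass (ρ.comp φ) x) =
      twistedClass ρ ⟨x.1.mapDomain φ, (barD₁_mapDomain ρ φ x.1).trans x.2⟩ := by
  refine (groupHomology.H1π_comp_map_apply (A := coeffRep (ρ.comp φ)) (B := coeffRep ρ) φ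
    (𝟙 (coeffRep (ρ.comp φ))) _).trans ?_
  refine congrArg (groupHomology.H1π (coeffRep ρ)) (Subtype.ext ?_)
  exact Finsupp.mapRange_id _

lemma TwistedHomology.map_injective (φ : A →* B) (ρ : B →* K)
    (h : ∀ c : A →₀ K, c.mapDomain φ ∈ LinearMap.range (barD₂ ρ) →
      c ∈ LinearMap.range (barD₂ (ρ.comp φ))) :
    Function.Injective (TwistedHomology.map φ ρ 1) := by
  rw [← LinearMap.ker_eq_bot, LinearMap.ker_eq_bot']
  intro x hx
  obtain ⟨c, rfl⟩ := twistedClass_surjective _ x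
  rw [map_twistedClass, twistedClass_eq_zero_iff] at hx
  exact (twistedClass_eq_zero_iff _ _).2 (h _ hx)

lemma TwistedHomology.twistedClass_mem_range (φ : A →* B) (ρ : B →* K)
    (b : LinearMap.ker (barD₁ ρ)) (c : A →₀ K)
    (h : b.1 - c.mapDomain φ ∈ LinearMap.range (barD₂ ρ)) :
    twistedClass ρ b ∈ LinearMap.range (TwistedHomology.map φ ρ 1) := by
  refine ⟨twistedClass _ ⟨c, barD₁_eq_zero_of_sub_mem b.2 h⟩, ?_⟩
  rw [map_twistedClass, ← sub_eq_zero, ← map_sub, twistedClass_eq_zero_iff]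
  have := Submodule.neg_mem _ h
  rwa [neg_sub] at this

end TwistedHomology

/-! ### Torsion and the comparison for PTFA groups -/

section Torsion

open MulOpposite

variable {A B R K : Type} [Group A] [Group B] [Ring R] [Algebra ℚ R] [DivisionRing K]
  {ι : R →+* K}

/-- A kernel that vanishes over the skew field of fractions is torsion. -/
theorem IsRightFractionField.isTorsionModule_ker_map (hι : IsRightFractionField ι) (φ : A →* B)
    (ρ : B →* R)
    (h : ∀ c : A →₀ K, c.mapDomain φ ∈ LinearMap.range (barD₂ ((ι : R →* K).comp ρ)) →
      c ∈ LinearMap.range (barD₂ (((ι : R →* K).comp ρ).comp φ))) :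
    IsTorsionModule Rᵐᵒᵖ (LinearMap.ker (TwistedHomology.map φ ρ 1)) := by
  rintro ⟨x, hx⟩
  obtain ⟨c, rfl⟩ := twistedClass_surjective _ x
  rw [LinearMap.mem_ker, TwistedHomology.map_twistedClass, twistedClass_eq_zero_iff] at hx
  obtain ⟨e, he⟩ := hx
  obtain ⟨y, hy⟩ := h (coeffMap ι c.1) ⟨coeffMap ι e, by
    rw [← coeffMap_barD₂, he, coeffMap_mapDomain]⟩
  obtain ⟨s, y', hs, hsy⟩ := hι.exists_common_denominator y
  refine ⟨op s, (op_ne_zero_iff s).2 hs, Subtype.ext ?_⟩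
  refine ((twistedClass (ρ.comp φ)).map_smul (op s) c).symm.trans
    ((twistedClass_eq_zero_iff _ _).2 ⟨y', coeffMap_injective hι.injective ?_⟩)
  rw [coeffMap_barD₂, ← hsy]
  refine ((barD₂ (((ι : R →* K).comp ρ).comp φ)).map_smul (op (ι s)) y).trans ?_
  rw [hy]
  exact (coeffMap_op_smul ι s c.1).symm

/-- A cokernel that vanishes over the skew field of fractions is torsion. -/
theorem IsRightFractionField.isTorsionModule_coker_map (hι : IsRightFractionField ι) (φ : A →* B)
    (ρ : B →* R)
    (h : ∀ b : B →₀ K, ∃ c : A →₀ K,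
      b - c.mapDomain φ ∈ LinearMap.range (barD₂ ((ι : R →* K).comp ρ))) :
    IsTorsionModule Rᵐᵒᵖ
      (TwistedHomology ρ 1 ⧸ LinearMap.range (TwistedHomology.map φ ρ 1)) := by
  intro x
  obtain ⟨x, rfl⟩ := Submodule.mkQ_surjective _ x
  obtain ⟨b, rfl⟩ := twistedClass_surjective _ x
  obtain ⟨c, e, he⟩ := h (coeffMap ι b.1)
  -- a common denominator of the coefficients of `c` and of `e`
  obtain ⟨s, y, hs, hsy⟩ := hι.exists_common_denominator (Finsupp.sumElim c e)
  obtain ⟨⟨c', e'⟩, rfl⟩ := Finsupp.sumFinsuppEquivProdFinsupp.symm.surjective y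
  have hc : op (ι s) • c = coeffMap ι c' := by
    ext i; simpa using DFunLike.congr_fun hsy (Sum.inl i)
  have he' : op (ι s) • e = coeffMap ι e' := by
    ext i; simpa using DFunLike.congr_fun hsy (Sum.inr i)
  refine ⟨op s, (op_ne_zero_iff s).2 hs, ?_⟩
  rw [← map_smul, ← map_smul, Submodule.mkQ_apply, Submodule.Quotient.mk_eq_zero]
  refine TwistedHomology.twistedClass_mem_range φ ρ _ c' ⟨e', coeffMap_injective hι.injective ?_⟩
  have h1 : op (ι s) • (barD₂ ((ι : R →* K).comp ρ)) e =
      op (ι s) • (coeffMap ι b.1 - c.mapDomain φ) := congrArg _ he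
  rw [← map_smul, he', ← coeffMap_barD₂, smul_sub, ← coeffMap_op_smul,
    ← Finsupp.mapDomain_smul, hc, ← coeffMap_mapDomain, ← map_sub] at h1
  exact h1

end Torsion

section PTFA

/-- A finite family `a` of generators of `A`, padded with trivial entries, lifts through a free
presentation `π` of `B` to a family `u` of words that contains relators defining `B`. -/
theorem exists_compatible_presentation {A B : Type} [Group A] [Group B] (φ : A →* B)
    (hA : Group.FG A) (hB : IsFinitelyRelated B) :
    ∃ (α I J : Type) (_ : Finite I) (π : FreeGroup α →* B) (a : I → A) (u : I → FreeGroup α)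
      (j : J → I), Function.Surjective π ∧ Subgroup.closure (Set.range a) = ⊤ ∧
        (∀ i, π (u i) = φ (a i)) ∧ (∀ k, a (j k) = 1) ∧
        π.ker = Subgroup.normalClosure (Set.range fun k => u (j k)) := by
  obtain ⟨S, hS⟩ := Group.fg_def.1 hA
  obtain ⟨α, rels, hrels, ⟨e⟩⟩ := hB
  have : Finite rels := hrels
  let π : FreeGroup α →* B := e.symm.toMonoidHom.comp (PresentedGroup.mk rels)
  have hπ : Function.Surjective π := e.symm.surjective.comp (PresentedGroup.mk_surjective rels)
  have hker : π.ker = Subgroup.normalClosure rels := by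
    rw [← QuotientGroup.ker_mk' (Subgroup.normalClosure rels)]
    exact MonoidHom.ker_mulEquiv_comp (PresentedGroup.mk rels) e.symm
  choose u hu using fun s : S => hπ (φ s)
  refine ⟨α, S ⊕ rels, rels, inferInstance, π, Sum.elim (fun s => s) fun _ => 1,
    Sum.elim u fun r => r, Sum.inr, hπ, ?_, ?_, fun _ => rfl, ?_⟩
  · refine top_le_iff.1 (hS ▸ Subgroup.closure_mono fun s hs => ⟨Sum.inl ⟨s, hs⟩, rfl⟩)
  · rintro (s | r)
    · exact hu s
    · refine ((hker ▸ Subgroup.subset_normalClosure r.2 : (r : FreeGroup α) ∈ π.ker) :).trans ?_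
      exact (map_one φ).symm
  · rw [hker]
    congr 1
    exact Subtype.range_coe.symm

variable {A B Γ K : Type} [Group A] [Group B] [Group Γ] [DivisionRing K]
  {ι : MonoidAlgebra ℚ Γ →+* K}

theorem IsPTFA.independenceCondition (hΓ : IsPTFA Γ) (hι : IsRightFractionField ι) :
    IndependenceCondition (augmentation Γ : MonoidAlgebra ℚ Γ →+* ℚ) ι :=
  fun _ _ C hC => hι.rightComb_injective (hΓ.strebelCondition.rightComb_injective C hC)

/-- Injectivity of `H₁(A; K) → H₁(B; K)` for the skew field of fractions `K` of the group ring of a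
PTFA group, on the level of chains. -/
theorem IsPTFA.mem_range_barD₂ (hΓ : IsPTFA Γ) (hι : IsRightFractionField ι) {φ : A →* B}
    (hA : Group.FG A) (hB : IsFinitelyRelated B)
    (hφ : Function.Injective (rationalHomologyMap φ 1)) (ψ : B →* Γ)
    (h : LinearMap.range (rationalHomologyMap φ 2) ⊔
      LinearMap.range (rationalHomologyMap ψ.ker.subtype 2) = ⊤) (c : A →₀ K)
    (hc : c.mapDomain φ ∈ LinearMap.range
      (barD₂ ((ι : MonoidAlgebra ℚ Γ →* K).comp ((MonoidAlgebra.of ℚ Γ).comp ψ)))) :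
    c ∈ LinearMap.range
      (barD₂ (((ι : MonoidAlgebra ℚ Γ →* K).comp ((MonoidAlgebra.of ℚ Γ).comp ψ)).comp φ)) := by
  obtain ⟨α, I, J, _, π, a, u, j, hπ, ha, hu, haj, hr⟩ := exists_compatible_presentation φ hA hB
  refine (hΓ.independenceCondition hι).mem_range_barD₂ φ π _ a u j
    (algebraMap ℚ (MonoidAlgebra ℚ Γ)) ?_ hπ ψ.ker ?_ (mem_range_barD₂_of_injective hφ)
    (exists_cycles_of_range_sup_range_eq_top φ ψ.ker.subtype h) ha hu haj hr c hc
  · intro b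
    exact augmentation_single (ψ b) 1
  · intro b hb
    rw [MonoidHom.comp_apply, MonoidHom.mem_ker.1 hb, map_one]

/-- Surjectivity of `H₁(A; K) → H₁(B; K)` for the skew field of fractions `K` of the group ring of a
PTFA group, on the level of chains. -/
theorem IsPTFA.exists_sub_mem_range_barD₂ (hΓ : IsPTFA Γ) (hι : IsRightFractionField ι)
    {φ : A →* B} (hA : Group.FG A) (hB : IsFinitelyRelated B)
    (hφ : Function.Surjective (rationalHomologyMap φ 1)) (ψ : B →* Γ) (b : B →₀ K) :
    ∃ c : A →₀ K, b - c.mapDomain φ ∈ LinearMap.range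
      (barD₂ ((ι : MonoidAlgebra ℚ Γ →* K).comp ((MonoidAlgebra.of ℚ Γ).comp ψ))) := by
  obtain ⟨α, I, J, _, π, a, u, j, hπ, ha, hu, haj, hr⟩ := exists_compatible_presentation φ hA hB
  exact (hΓ.independenceCondition hι).exists_sub_mem_range_barD₂ φ π _ a u j
    (algebraMap ℚ (MonoidAlgebra ℚ Γ)) (fun b => augmentation_single (ψ b) 1) hπ
    (exists_sub_mem_range_barD₂_of_surjective hφ) ha hu hr b

end PTFA

theorem proposition2 (A B : Type) [Group A] [Group B] (φ : A →* B)
    (hA : Group.FG A) (hB : IsFinitelyRelated B)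
    (hφ : Function.Injective (rationalHomologyMap φ 1)) :
    (∀ (B₀ : Subgroup B) [B₀.Normal], IsPTFA (B ⧸ B₀) →
      LinearMap.range (rationalHomologyMap φ 2) ⊔
        LinearMap.range (rationalHomologyMap B₀.subtype 2) = ⊤ →
      IsTorsionModule (MonoidAlgebra ℚ (B ⧸ B₀))ᵐᵒᵖ
        (LinearMap.ker (TwistedHomology.map φ
          ((MonoidAlgebra.of ℚ (B ⧸ B₀)).comp (QuotientGroup.mk' B₀)) 1)) ∧
      (Function.Surjective (rationalHomologyMap φ 1) →
        IsTorsionModule (MonoidAlgebra ℚ (B ⧸ B₀))ᵐᵒᵖ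
          (TwistedHomology ((MonoidAlgebra.of ℚ (B ⧸ B₀)).comp (QuotientGroup.mk' B₀)) 1 ⧸
            LinearMap.range (TwistedHomology.map φ
              ((MonoidAlgebra.of ℚ (B ⧸ B₀)).comp (QuotientGroup.mk' B₀)) 1)))) ∧
    (∀ (Γ : Type) [Group Γ] (ψ : B →* Γ), IsPTFA Γ →
      LinearMap.range (rationalHomologyMap φ 2) ⊔
        LinearMap.range (rationalHomologyMap ψ.ker.subtype 2) = ⊤ →
      (∃ (K : Type) (_ : DivisionRing K) (_ : Algebra ℚ K) (ι : MonoidAlgebra ℚ Γ →ₐ[ℚ] K),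
        IsRightFractionField (ι : MonoidAlgebra ℚ Γ →+* K)) ∧
      ∀ (K : Type) [DivisionRing K] [Algebra ℚ K] (ι : MonoidAlgebra ℚ Γ →ₐ[ℚ] K),
        IsRightFractionField (ι : MonoidAlgebra ℚ Γ →+* K) →
        Function.Injective (TwistedHomology.map φ
          (((ι : MonoidAlgebra ℚ Γ →* K).comp (MonoidAlgebra.of ℚ Γ)).comp ψ) 1) ∧
        (Function.Surjective (rationalHomologyMap φ 1) →
          Function.Bijective (TwistedHomology.map φ
            (((ι : MonoidAlgebra ℚ Γ →* K).comp (MonoidAlgebra.of ℚ Γ)).comp ψ) 1))) := by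

  refine ⟨fun B₀ _ hΓ h => ?_, fun Γ _ ψ hΓ h => ⟨hΓ.exists_isRightFractionField, ?_⟩⟩
  · obtain ⟨K, _, _, ι, hι⟩ := hΓ.exists_isRightFractionField
    have h' : LinearMap.range (rationalHomologyMap φ 2) ⊔
        LinearMap.range (rationalHomologyMap (QuotientGroup.mk' B₀).ker.subtype 2) = ⊤ := by
      rwa [QuotientGroup.ker_mk']
    exact ⟨hι.isTorsionModule_ker_map φ _ (hΓ.mem_range_barD₂ hι hA hB hφ _ h'),
      fun hφ' => hι.isTorsionModule_coker_map φ _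
        (hΓ.exists_sub_mem_range_barD₂ hι hA hB hφ' _)⟩
  · intro K _ _ ι hι
    have hinj := TwistedHomology.map_injective φ _ (hΓ.mem_range_barD₂ hι hA hB hφ ψ h)
    refine ⟨hinj, fun hφ' => ⟨hinj, fun x => ?_⟩⟩
    obtain ⟨b, rfl⟩ := twistedClass_surjective _ x
    obtain ⟨c, hc⟩ := hΓ.exists_sub_mem_range_barD₂ hι hA hB hφ' ψ b.1
    exact TwistedHomology.twistedClass_mem_range φ _ b c hc
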